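/- \textbf{Theorem.} Let $p,q$ be coprime positive integers with $\tfrac12\le \tfrac pq<1$, let $n\ge 0$, let $a_i^-\le a_i^+$ $(0\le i\le n)$ be real numbers, and put $$K=\{a_0+a_1s+\dots+a_ns^n : a_i\in[a_i^-,a_i^+]\},\qquad D=\{\rho e^{j\theta}:\rho>0,\ \tfrac{p\pi}{q}<\theta<2\pi-\tfrac{p\pi}{q}\}.$$ For a sign vector $\sigma\in\{+,-\}^{n+1}$ let $f_\sigma(s)=\sum_{i=0}^n a_i^{\sigma_i}s^i$ be the vertex polynomial with superscript $\sigma$. A vertex polynomial $f_\sigma$ is called \emph{critical} if for some $z=\rho e^{\pm jp\pi/q}$, $\rho>0$, on one of the two rays bounding $D$, the number $f_\sigma(z)$ is an extreme point of the value set $\{f(z):f\in K\}$. Arrange $2q$ signs on a circle, $q$ signs $+$ in a row followed by $q$ signs $-$. For each of the $2q$ starting points $x$ on the circle, let $\sigma^{(x)}\in\{+,-\}^{n+1}$ be the sign at $x$ followed by the signs met in $n$ successive moves of step length $p$ in the fixed (clockwise) direction. Then: (1) If $a_i^-<a_i^+$ for all $i$, the set of sign vectors $\sigma^{(x)}$ is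 exactly the set of superscripts of the critical vertex polynomials, and the number of critical vertex polynomials is $2\min(q,n+1)$ (thus $2q$ when $n\ge q-1$). (2) In general (intervals reduced to a point being allowed), the polynomials $f_{\sigma^{(x)}}$ are exactly the critical vertex polynomials. (3) If $0\notin[a_n^-,a_n^+]$ (so that every member of $K$ has order $n$), then all roots of all polynomials in $K$ lie in $D$ if and only if, for every starting point $x$, all roots of $f_{\sigma^{(x)}}$ lie in $D$. -/

import Mathlib

open Polynomial

namespace LeftSector

/-- The polynomial `a_0 + a_1 s + ⋯ + a_n s^n` with coefficient vector `a`. -/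
noncomputable def polyOf {n : ℕ} (a : Fin (n + 1) → ℝ) : ℝ[X] :=
  ∑ i : Fin (n + 1), Polynomial.C (a i) * Polynomial.X ^ (i : ℕ)

/-- The interval family: all `a_0 + ⋯ + a_n s^n` with `a_i ∈ [lo i, hi i]`. -/
def intervalFamily {n : ℕ} (lo hi : Fin (n + 1) → ℝ) : Set ℝ[X] :=
  {f | ∃ a : Fin (n + 1) → ℝ, (∀ i, a i ∈ Set.Icc (lo i) (hi i)) ∧ f = polyOf a}

/-- The open left sector `{ρ e^{jθ} : ρ > 0, pπ/q < θ < 2π - pπ/q}`. -/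
def sector (p q : ℕ) : Set ℂ :=
  {z | ∃ ρ θ : ℝ, 0 < ρ ∧ (p : ℝ) * Real.pi / q < θ ∧ θ < 2 * Real.pi - (p : ℝ) * Real.pi / q ∧
    z = (ρ : ℂ) * Complex.exp (θ * Complex.I)}

/-- The two open rays `{ρ e^{± j pπ/q} : ρ > 0}` bounding the sector. -/
def boundaryRays (p q : ℕ) : Set ℂ :=
  {z | ∃ ρ θ : ℝ, 0 < ρ ∧ (θ = (p : ℝ) * Real.pi / q ∨ θ = -((p : ℝ) * Real.pi / q)) ∧
    z = (ρ : ℂ) * Complex.exp (θ * Complex.I)}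

/-- All complex roots of `f` lie in the sector. -/
def SectorStable (p q : ℕ) (f : ℝ[X]) : Prop :=
  ∀ z : ℂ, Polynomial.aeval z f = 0 → z ∈ sector p q

/-- A superscript: one sign for each coefficient (`true` is `+`, `false` is `-`). -/
abbrev Superscript (n : ℕ) : Type := Fin (n + 1) → Bool

/-- The vertex polynomial with superscript `σ`: the coefficient of `s^i` is the upper endpoint
of the `i`-th interval when `σ i` is `+`, and the lower endpoint when it is `-`. -/
noncomputable def vertexPoly {n : ℕ} (lo hi : Fin (n + 1) → ℝ) (σ : Superscript n) : ℝ[X] :=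
  polyOf (fun i => if σ i = true then hi i else lo i)

/-- The value set of the interval family at `z`. -/
def valueSet {n : ℕ} (lo hi : Fin (n + 1) → ℝ) (z : ℂ) : Set ℂ :=
  (fun f : ℝ[X] => Polynomial.aeval z f) '' intervalFamily lo hi

/-- The critical vertices: the vertex polynomials whose value, at some point of the rays bounding
the sector, is a corner (extreme point) of the value set, which is a convex polygon. -/
def criticalVertices {n : ℕ} (p q : ℕ) (lo hi : Fin (n + 1) → ℝ) : Set ℝ[X] :=
  {f | (∃ σ : Superscript n, f = vertexPoly lo hi σ) ∧
    ∃ z ∈ boundaryRays p q, Polynomial.aeval z f ∈ Set.extremePoints ℝ (valueSet lo hi z)}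

/-- The circle of `2q` signs: `q` consecutive signs `+` followed by `q` consecutive signs `-`. -/
def signCircle (q : ℕ) (x : ZMod (2 * q)) : Bool := decide (x.val < q)

/-- The superscript read off the circle from the starting point `x`: the sign at `x`, then the
signs met in `n` moves of step length `p`. -/
def circlePattern (n p q : ℕ) (x : ZMod (2 * q)) : Superscript n :=
  fun i => signCircle q (x + ((i : ℕ) : ZMod (2 * q)) * (p : ZMod (2 * q)))

end LeftSector

/-! Write φ = pπ/q. At z = ρe^{jφ} the functional w ↦ Im(e^{-jβ}w) sends f(z) to Σ a_i ρ^i sin(iφ -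
β). For β = (m - t)π/q with 0 < t < 1 the i-th angle is (ip - m + t)π/q, so the sign of its sine
depends only on whether ip - m mod 2q is below q, and not on ρ or t. Hence the vertex read off the
circle from -m is the unique maximizer over the box, and its value is extreme. Conversely, the
nontrivial edge vectors leaving an extreme vertex value lie in an open half-plane
(`exists_functional_of_extreme`), and the functional defining it forces the signs of the circle. The
pattern changes only when some ip - m is divisible by q; coprimality counts these m modulo 2q.

For stability, the value set on the ray is a polygon whose edge directions mπ/q do not depend on ρ.
If 0 lay on an edge line while belonging to the polygon, it would lie between the two end vertices
of that edge. These have the same velocity normal to the edge, whereas the phase of each, being that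
of a stable polynomial, increases with ρ (`im_logDeriv_pos`), which demands opposite normal
velocities. So 0 cannot enter through an edge (`support_pos_of_zero_mem`). It is outside at ρ = 0,
hence outside for all ρ (`zero_notMem_valueSet`), and continuity of roots over the connected box
(`forall_root_neg_of_exists`) carries stability from one vertex to the family. -/

namespace LeftSector

/-- The coefficient vector of the vertex polynomial with superscript `σ`. -/
def vertexCoeff {n : ℕ} (lo hi : Fin (n + 1) → ℝ) (σ : Superscript n) : Fin (n + 1) → ℝ :=
  fun i => if σ i = true then hi i else lo i

lemma vertexPoly_eq {n : ℕ} (lo hi : Fin (n + 1) → ℝ) (σ : Superscript n) :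
    vertexPoly lo hi σ = polyOf (vertexCoeff lo hi σ) := rfl

lemma vertexCoeff_mem {n : ℕ} {lo hi : Fin (n + 1) → ℝ} (hle : ∀ i, lo i ≤ hi i)
    (σ : Superscript n) (i : Fin (n + 1)) :
    vertexCoeff lo hi σ i ∈ Set.Icc (lo i) (hi i) := by
  unfold vertexCoeff
  split_ifs
  · exact ⟨hle i, le_rfl⟩
  · exact ⟨le_rfl, hle i⟩

lemma aeval_polyOf {n : ℕ} (a : Fin (n + 1) → ℝ) (z : ℂ) :
    aeval z (polyOf a) = ∑ i : Fin (n + 1), (a i : ℂ) * z ^ (i : ℕ) := by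
  simp [polyOf, map_sum]

lemma coeff_polyOf {n : ℕ} (a : Fin (n + 1) → ℝ) (i : Fin (n + 1)) :
    (polyOf a).coeff (i : ℕ) = a i := by
  simp only [polyOf, finsetSum_coeff, coeff_C_mul, coeff_X_pow]
  rw [Finset.sum_eq_single i]
  · simp
  · intro j _ hj
    have : (i : ℕ) ≠ j := fun h => hj (Fin.ext h.symm)
    simp [this]
  · simp

lemma polyOf_injective {n : ℕ} : Function.Injective (polyOf (n := n)) := by
  intro a b h
  funext i
  rw [← coeff_polyOf a i, h, coeff_polyOf]

/-! ### Functionals given by rotated imaginary parts -/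

/-- The real part of `w` rotated by `-(β + π/2)`, as a real-linear functional. -/
noncomputable def rotIm (β : ℝ) (w : ℂ) : ℝ := (Complex.exp (-(β : ℂ) * Complex.I) * w).im

lemma rotIm_add (β : ℝ) (v w : ℂ) : rotIm β (v + w) = rotIm β v + rotIm β w := by
  simp only [rotIm, mul_add, Complex.add_im]

lemma rotIm_real_mul (β r : ℝ) (w : ℂ) : rotIm β ((r : ℂ) * w) = r * rotIm β w := by
  rw [rotIm, mul_left_comm, Complex.im_ofReal_mul, rotIm]

lemma rotIm_exp (β ρ θ : ℝ) (k : ℕ) :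
    rotIm β (((ρ : ℂ) * Complex.exp (θ * Complex.I)) ^ k) = ρ ^ k * Real.sin (k * θ - β) := by
  have : ((ρ : ℂ) * Complex.exp (θ * Complex.I)) ^ k =
      ((ρ ^ k : ℝ) : ℂ) * Complex.exp (((k * θ : ℝ) : ℂ) * Complex.I) := by
    rw [mul_pow, ← Complex.exp_nat_mul]
    push_cast
    rw [mul_assoc]
  rw [this, rotIm_real_mul, rotIm, ← Complex.exp_add]
  have : -(β : ℂ) * Complex.I + ((k * θ : ℝ) : ℂ) * Complex.I =
      ((k * θ - β : ℝ) : ℂ) * Complex.I := by push_cast; ring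
  rw [this, Complex.exp_ofReal_mul_I_im]

lemma rotIm_sum {ι : Type*} (s : Finset ι) (β : ℝ) (c : ι → ℝ) (w : ι → ℂ) :
    rotIm β (∑ i ∈ s, (c i : ℂ) * w i) = ∑ i ∈ s, c i * rotIm β (w i) := by
  classical
  induction s using Finset.induction_on with
  | empty => simp [rotIm]
  | insert a s ha ih => rw [Finset.sum_insert ha, Finset.sum_insert ha, rotIm_add, ih,
      rotIm_real_mul]

lemma rotIm_aeval {n : ℕ} (a : Fin (n + 1) → ℝ) (β ρ θ : ℝ) :
    rotIm β (aeval ((ρ : ℂ) * Complex.exp (θ * Complex.I)) (polyOf a)) =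
      ∑ i : Fin (n + 1), a i * (ρ ^ (i : ℕ) * Real.sin ((i : ℕ) * θ - β)) := by
  rw [aeval_polyOf, rotIm_sum]
  simp only [rotIm_exp]

/-! ### Signs of sines between multiples of π/q -/

lemma sin_add_int_period {q : ℕ} (hq : 0 < q) (k : ℤ) (t : ℝ) :
    Real.sin ((k + t) * Real.pi / q) =
      Real.sin ((((k % (2 * q) : ℤ) : ℝ) + t) * Real.pi / q) := by
  have hq' : (q : ℝ) ≠ 0 := by positivity
  have h := Int.emod_add_mul_ediv k (2 * q)
  have h' : (k : ℝ) = ((k % (2 * q) : ℤ) : ℝ) + 2 * q * ((k / (2 * q) : ℤ) : ℝ) := by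
    exact_mod_cast h.symm
  rw [← Real.sin_add_int_mul_two_pi ((((k % (2 * q) : ℤ) : ℝ) + t) * Real.pi / q) (k / (2 * q))]
  congr 1
  have h'' : (k : ℝ) + t =
      ((k % (2 * q) : ℤ) : ℝ) + t + 2 * q * ((k / (2 * q) : ℤ) : ℝ) := by rw [h']; ring
  rw [h'']
  field_simp

lemma sin_nonneg_of_emod_lt {q : ℕ} (hq : 0 < q) {k : ℤ} {t : ℝ} (ht0 : 0 ≤ t) (ht1 : t ≤ 1)
    (h : k % (2 * q) < q) : 0 ≤ Real.sin ((k + t) * Real.pi / q) := by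
  have hq' : (0 : ℝ) < q := by positivity
  rw [sin_add_int_period hq]
  have h0 : (0 : ℝ) ≤ ((k % (2 * q) : ℤ) : ℝ) := by
    exact_mod_cast Int.emod_nonneg k (by positivity)
  have h1 : ((k % (2 * q) : ℤ) : ℝ) + 1 ≤ q := by exact_mod_cast h
  apply Real.sin_nonneg_of_nonneg_of_le_pi
  · positivity
  · rw [div_le_iff₀ hq', mul_comm]
    gcongr
    linarith

lemma sin_pos_of_emod_lt {q : ℕ} (hq : 0 < q) {k : ℤ} {t : ℝ} (ht0 : 0 < t) (ht1 : t < 1)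
    (h : k % (2 * q) < q) : 0 < Real.sin ((k + t) * Real.pi / q) := by
  have hq' : (0 : ℝ) < q := by positivity
  rw [sin_add_int_period hq]
  have h0 : (0 : ℝ) ≤ ((k % (2 * q) : ℤ) : ℝ) := by
    exact_mod_cast Int.emod_nonneg k (by positivity)
  have h1 : ((k % (2 * q) : ℤ) : ℝ) + 1 ≤ q := by exact_mod_cast h
  have := Real.pi_pos
  apply Real.sin_pos_of_pos_of_lt_pi
  · positivity
  · rw [div_lt_iff₀ hq', mul_comm]
    gcongr
    linarith

lemma emod_sub_lt {q : ℕ} {k : ℤ} (h : ¬ k % (2 * q) < q) (hq : 0 < q) :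
    (k - q) % (2 * q) < q := by
  have h1 := Int.emod_lt_of_pos k (show (0 : ℤ) < 2 * q by positivity)
  rw [Int.sub_emod, Int.emod_eq_of_lt (a := (q : ℤ)) (by positivity) (by omega),
    Int.emod_eq_of_lt (by omega) (by omega)]
  omega

lemma sin_sub_half_turn {q : ℕ} (hq : 0 < q) (k : ℤ) (t : ℝ) :
    Real.sin (((k - q : ℤ) + t) * Real.pi / q) = -Real.sin ((k + t) * Real.pi / q) := by
  have hq' : (q : ℝ) ≠ 0 := by positivity
  rw [← Real.sin_sub_pi]
  congr 1
  push_cast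
  field_simp
  ring

lemma sin_nonpos_of_not_emod_lt {q : ℕ} (hq : 0 < q) {k : ℤ} {t : ℝ} (ht0 : 0 ≤ t) (ht1 : t ≤ 1)
    (h : ¬ k % (2 * q) < q) : Real.sin ((k + t) * Real.pi / q) ≤ 0 := by
  have := sin_nonneg_of_emod_lt hq ht0 ht1 (emod_sub_lt h hq)
  rw [sin_sub_half_turn hq] at this
  linarith

lemma sin_neg_of_not_emod_lt {q : ℕ} (hq : 0 < q) {k : ℤ} {t : ℝ} (ht0 : 0 < t) (ht1 : t < 1)
    (h : ¬ k % (2 * q) < q) : Real.sin ((k + t) * Real.pi / q) < 0 := by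
  have := sin_pos_of_emod_lt hq ht0 ht1 (emod_sub_lt h hq)
  rw [sin_sub_half_turn hq] at this
  linarith

/-! ### Circle patterns indexed by integers -/

/-- The superscript whose `i`-th sign is read at position `i p - m` of the circle. -/
def rotPattern (n p q : ℕ) (m : ℤ) : Superscript n :=
  fun i => decide (((i : ℕ) * p - m : ℤ) % (2 * q) < q)

/-- Turning the direction β forward by π/q moves the starting point one place back, hence the sign
of `m`. -/
lemma circlePattern_intCast (n p q : ℕ) (hq : 0 < q) (m : ℤ) :
    circlePattern n p q ((-m : ℤ) : ZMod (2 * q)) = rotPattern n p q m := by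
  have : NeZero (2 * q) := ⟨by omega⟩
  funext i
  have h : ((-m : ℤ) : ZMod (2 * q)) + ((i : ℕ) : ZMod (2 * q)) * (p : ZMod (2 * q)) =
      (((i : ℕ) * p - m : ℤ) : ZMod (2 * q)) := by push_cast; ring
  have h2 := ZMod.val_intCast (n := 2 * q) ((i : ℕ) * p - m : ℤ)
  unfold circlePattern signCircle rotPattern
  rw [h, decide_eq_decide]
  push_cast at h2 ⊢
  rw [← h2]
  norm_cast

lemma range_circlePattern {n p q : ℕ} (hq : 0 < q) {α : Type*} (F : Superscript n → α) :
    Set.range (fun x : ZMod (2 * q) => F (circlePattern n p q x)) =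
      Set.range (fun m : ℤ => F (rotPattern n p q m)) := by
  ext y
  constructor
  · rintro ⟨x, rfl⟩
    obtain ⟨m, rfl⟩ := ZMod.intCast_surjective x
    refine ⟨-m, ?_⟩
    simp only [← circlePattern_intCast n p q hq, neg_neg]
  · rintro ⟨m, rfl⟩
    exact ⟨_, congrArg F (circlePattern_intCast n p q hq m)⟩

/-! ### Vertices maximizing a functional -/

section Maximal

variable {n p q : ℕ} {lo hi a : Fin (n + 1) → ℝ}

/-- The vertex with pattern `m` maximizes, coefficientwise, each functional `rotIm β` with `β`
between `(m - 1)π/q` and `mπ/q`. -/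
lemma coeff_mul_sin_le (hq : 0 < q) (ha : ∀ i, a i ∈ Set.Icc (lo i) (hi i)) {t : ℝ}
    (ht0 : 0 ≤ t) (ht1 : t ≤ 1) (m : ℤ) {ρ : ℝ} (hρ : 0 ≤ ρ) (i : Fin (n + 1)) :
    a i * (ρ ^ (i : ℕ) * Real.sin ((i : ℕ) * (p * Real.pi / q) - (m - t) * Real.pi / q)) ≤
      vertexCoeff lo hi (rotPattern n p q m) i *
        (ρ ^ (i : ℕ) * Real.sin ((i : ℕ) * (p * Real.pi / q) - (m - t) * Real.pi / q)) := by
  have e : (i : ℕ) * (p * Real.pi / q) - (m - t) * Real.pi / q =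
      ((((i : ℕ) * p - m : ℤ) : ℝ) + t) * Real.pi / q := by push_cast; ring
  have hρi : 0 ≤ ρ ^ (i : ℕ) := by positivity
  rw [e]
  unfold vertexCoeff rotPattern
  by_cases h : ((i : ℕ) * p - m : ℤ) % (2 * q) < q
  · simp only [h, decide_true, if_true]
    exact mul_le_mul_of_nonneg_right (ha i).2
      (mul_nonneg hρi (sin_nonneg_of_emod_lt hq ht0 ht1 h))
  · simp only [h, decide_false, Bool.false_eq_true, if_false]
    exact mul_le_mul_of_nonpos_right (ha i).1
      (mul_nonpos_of_nonneg_of_nonpos hρi (sin_nonpos_of_not_emod_lt hq ht0 ht1 h))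

lemma rotIm_le_rotPattern (hq : 0 < q) (ha : ∀ i, a i ∈ Set.Icc (lo i) (hi i)) {t : ℝ}
    (ht0 : 0 ≤ t) (ht1 : t ≤ 1) (m : ℤ) {ρ : ℝ} (hρ : 0 ≤ ρ) :
    rotIm ((m - t) * Real.pi / q)
        (aeval ((ρ : ℂ) * Complex.exp ((p * Real.pi / q : ℝ) * Complex.I)) (polyOf a)) ≤
      rotIm ((m - t) * Real.pi / q)
        (aeval ((ρ : ℂ) * Complex.exp ((p * Real.pi / q : ℝ) * Complex.I))
          (vertexPoly lo hi (rotPattern n p q m))) := by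
  rw [vertexPoly_eq, rotIm_aeval, rotIm_aeval]
  exact Finset.sum_le_sum fun i _ => coeff_mul_sin_le hq ha ht0 ht1 m hρ i

/-- If a member of the family attains the maximum, it does so in each coefficient. -/
lemma coeff_eq_of_rotIm_le (hq : 0 < q) (ha : ∀ i, a i ∈ Set.Icc (lo i) (hi i)) {t : ℝ}
    (ht0 : 0 ≤ t) (ht1 : t ≤ 1) (m : ℤ) {ρ : ℝ} (hρ : 0 < ρ)
    (h : rotIm ((m - t) * Real.pi / q)
        (aeval ((ρ : ℂ) * Complex.exp ((p * Real.pi / q : ℝ) * Complex.I))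
          (vertexPoly lo hi (rotPattern n p q m))) ≤
      rotIm ((m - t) * Real.pi / q)
        (aeval ((ρ : ℂ) * Complex.exp ((p * Real.pi / q : ℝ) * Complex.I)) (polyOf a)))
    (i : Fin (n + 1))
    (hs : Real.sin ((i : ℕ) * (p * Real.pi / q) - (m - t) * Real.pi / q) ≠ 0) :
    a i = vertexCoeff lo hi (rotPattern n p q m) i := by
  rw [vertexPoly_eq, rotIm_aeval, rotIm_aeval] at h
  have h1 := (Finset.sum_eq_sum_iff_of_le
    fun i _ => coeff_mul_sin_le hq ha ht0 ht1 m hρ.le i).1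
    (le_antisymm (Finset.sum_le_sum fun i _ => coeff_mul_sin_le hq ha ht0 ht1 m hρ.le i) h)
    i (Finset.mem_univ i)
  exact mul_right_cancel₀ (mul_ne_zero (by positivity) hs) h1

/-- With t = 1/2 no angle is a multiple of π/q, so no sine vanishes and the maximizer is unique as a
coefficient vector, even when some intervals are points. -/
lemma coeff_eq_of_rotIm_half_le (hq : 0 < q) (ha : ∀ i, a i ∈ Set.Icc (lo i) (hi i)) (m : ℤ)
    {ρ : ℝ} (hρ : 0 < ρ)
    (h : rotIm ((m - (1 / 2 : ℝ)) * Real.pi / q)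
        (aeval ((ρ : ℂ) * Complex.exp ((p * Real.pi / q : ℝ) * Complex.I))
          (vertexPoly lo hi (rotPattern n p q m))) ≤
      rotIm ((m - (1 / 2 : ℝ)) * Real.pi / q)
        (aeval ((ρ : ℂ) * Complex.exp ((p * Real.pi / q : ℝ) * Complex.I)) (polyOf a))) :
    a = vertexCoeff lo hi (rotPattern n p q m) := by
  funext i
  refine coeff_eq_of_rotIm_le hq ha (by norm_num) (by norm_num) m hρ h i ?_
  have e : (i : ℕ) * (p * Real.pi / q) - (m - (1 / 2 : ℝ)) * Real.pi / q =
      ((((i : ℕ) * p - m : ℤ) : ℝ) + (1 / 2 : ℝ)) * Real.pi / q := by push_cast; ring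
  rw [e]
  by_cases h : ((i : ℕ) * p - m : ℤ) % (2 * q) < q
  · exact (sin_pos_of_emod_lt hq (by norm_num) (by norm_num) h).ne'
  · exact (sin_neg_of_not_emod_lt hq (by norm_num) (by norm_num) h).ne

end Maximal

/-! ### Critical vertices are those read off the circle -/

lemma rotIm_linear_comb (β a b : ℝ) (v w : ℂ) :
    rotIm β (a • v + b • w) = a * rotIm β v + b * rotIm β w := by
  rw [rotIm_add, Complex.real_smul, Complex.real_smul, rotIm_real_mul, rotIm_real_mul]

lemma mem_valueSet_iff {n : ℕ} {lo hi : Fin (n + 1) → ℝ} {z w : ℂ} :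
    w ∈ valueSet lo hi z ↔
      ∃ a : Fin (n + 1) → ℝ, (∀ i, a i ∈ Set.Icc (lo i) (hi i)) ∧ aeval z (polyOf a) = w := by
  constructor
  · rintro ⟨_, ⟨a, ha, rfl⟩, rfl⟩
    exact ⟨a, ha, rfl⟩
  · rintro ⟨a, ha, rfl⟩
    exact ⟨_, ⟨a, ha, rfl⟩, rfl⟩

/-- Every vertex read off the circle is critical. -/
lemma rotPattern_mem_criticalVertices {n p q : ℕ} (hq : 0 < q) {lo hi : Fin (n + 1) → ℝ}
    (hle : ∀ i, lo i ≤ hi i) (m : ℤ) :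
    vertexPoly lo hi (rotPattern n p q m) ∈ criticalVertices p q lo hi := by
  refine ⟨⟨_, rfl⟩, ((1 : ℝ) : ℂ) * Complex.exp ((p * Real.pi / q : ℝ) * Complex.I),
    ⟨1, _, one_pos, Or.inl rfl, rfl⟩, ?_⟩
  refine ⟨mem_valueSet_iff.2 ⟨_, vertexCoeff_mem hle _, rfl⟩, ?_⟩
  intro v hv w hw hvw
  obtain ⟨a, ha, rfl⟩ := mem_valueSet_iff.1 hv
  obtain ⟨b, hb, rfl⟩ := mem_valueSet_iff.1 hw
  obtain ⟨s, t, hs, ht, hst, h⟩ := hvw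
  have h1 := rotIm_le_rotPattern (p := p) hq ha (t := 1 / 2) (by norm_num) (by norm_num) m
    zero_le_one
  have h2 := rotIm_le_rotPattern (p := p) hq hb (t := 1 / 2) (by norm_num) (by norm_num) m
    zero_le_one
  have h3 := congrArg (rotIm ((m - (1 / 2 : ℝ)) * Real.pi / q)) h
  rw [rotIm_linear_comb] at h3
  -- A convex combination of two values bounded by the maximum equals it with positive weights, so
  -- the first value attains the maximum too.
  rw [coeff_eq_of_rotIm_half_le (p := p) hq ha m one_pos, vertexPoly_eq]
  obtain rfl : t = 1 - s := by linarith
  nlinarith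

/-- Every real functional on ℂ is w ↦ Im(cw) with c = l(i) + i l(1); the polar form of c gives r and
β. -/
lemma exists_im_form (l : ℂ →L[ℝ] ℝ) : ∃ r β : ℝ, 0 ≤ r ∧ ∀ w, l w = r * rotIm β w := by
  let c : ℂ := ⟨l Complex.I, l 1⟩
  refine ⟨‖c‖, -c.arg, norm_nonneg _, fun w => ?_⟩
  have h1 : l w = (c * w).im := by
    have : w = w.re • (1 : ℂ) + w.im • Complex.I := by
      apply Complex.ext <;> simp
    conv_lhs => rw [this]
    rw [map_add, map_smul, map_smul, Complex.mul_im]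
    simp only [c, smul_eq_mul]
    ring
  rw [h1, rotIm, ← Complex.im_ofReal_mul, ← mul_assoc]
  congr 2
  rw [← Complex.norm_mul_exp_arg_mul_I c]
  simp

/-- At a point where the value of a vertex is extreme, some functional separates it strictly from
all neighbouring vertices. -/
lemma exists_functional_of_extreme {n : ℕ} {lo hi : Fin (n + 1) → ℝ} (hle : ∀ i, lo i ≤ hi i)
    (σ : Superscript n) {z : ℂ} (hz : z ≠ 0)
    (hext : aeval z (vertexPoly lo hi σ) ∈ Set.extremePoints ℝ (valueSet lo hi z)) :
    ∃ l : ℂ →L[ℝ] ℝ, ∀ i, lo i < hi i →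
      0 < (if σ i = true then 1 else -1) * l (z ^ (i : ℕ)) := by
  classical
  let δ : Fin (n + 1) → ℝ := fun i => if σ i = true then lo i - hi i else hi i - lo i
  -- Weights of convex combinations of the edge vectors `δ i * z ^ i` leaving the vertex value;
  -- point intervals, where `δ` vanishes, get weight zero.
  let S : Set (Fin (n + 1) → ℝ) :=
    stdSimplex ℝ (Fin (n + 1)) ∩ {c | ∀ i, lo i = hi i → c i = 0}
  let L : (Fin (n + 1) → ℝ) →L[ℝ] ℂ :=
    ∑ i, (ContinuousLinearMap.proj (R := ℝ) (φ := fun _ : Fin (n + 1) => ℝ) i).smulRight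
      ((δ i : ℂ) * z ^ (i : ℕ))
  have hL : ∀ c, L c = ∑ i, ((c i * δ i : ℝ) : ℂ) * z ^ (i : ℕ) := by
    intro c
    simp [L, mul_assoc]
  have hScl : IsClosed {c : Fin (n + 1) → ℝ | ∀ i, lo i = hi i → c i = 0} := by
    simp only [Set.ofPred_forall]
    exact isClosed_iInter fun i => isClosed_iInter fun _ =>
      isClosed_eq (continuous_apply i) continuous_const
  have hScompact : IsCompact S := (isCompact_stdSimplex ℝ _).inter_right hScl
  have hSconv : Convex ℝ S := by
    refine (convex_stdSimplex ℝ _).inter ?_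
    intro c hc d hd s t _ _ _ i hi'
    simp [hc i hi', hd i hi']
  have hbox : ∀ c : Fin (n + 1) → ℝ, (∀ i, c i ∈ Set.Icc (0 : ℝ) 1) → ∀ i,
      vertexCoeff lo hi σ i + c i * δ i ∈ Set.Icc (lo i) (hi i) := by
    intro c hc i
    have := hle i
    obtain ⟨h0, h1⟩ := hc i
    simp only [vertexCoeff, δ]
    split_ifs <;> constructor <;> nlinarith
  have h0 : (0 : ℂ) ∉ L '' S := by
    rintro ⟨c, ⟨hc, hc'⟩, hc0⟩
    have hc1 : ∀ i, c i ∈ Set.Icc (0 : ℝ) 1 := fun i => ⟨hc.1 i, by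
      rw [← hc.2]; exact Finset.single_le_sum (fun j _ => hc.1 j) (Finset.mem_univ i)⟩
    obtain ⟨k, hk⟩ : ∃ k, c k ≠ 0 := by
      by_contra! h
      have := hc.2
      simp [h] at this
    -- Separating one active edge from the rest makes the vertex value the midpoint of two values of
    -- the family. Extremality then forces that edge's contribution to vanish, although it is
    -- nonzero.
    let c₁ : Fin (n + 1) → ℝ := fun i => if i = k then c k else 0
    let c₂ : Fin (n + 1) → ℝ := fun i => if i = k then 0 else c i
    have hc₁ : ∀ i, c₁ i ∈ Set.Icc (0 : ℝ) 1 := by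
      intro i; simp only [c₁]; split_ifs
      · exact hc1 k
      · simp
    have hc₂ : ∀ i, c₂ i ∈ Set.Icc (0 : ℝ) 1 := by
      intro i; simp only [c₂]; split_ifs
      · simp
      · exact hc1 i
    have hval : ∀ d : Fin (n + 1) → ℝ,
        aeval z (polyOf fun i => vertexCoeff lo hi σ i + d i * δ i) =
          aeval z (vertexPoly lo hi σ) + L d := by
      intro d
      rw [vertexPoly_eq, aeval_polyOf, aeval_polyOf, hL, ← Finset.sum_add_distrib]
      refine Finset.sum_congr rfl fun i _ => ?_
      push_cast
      ring
    have hsum : L c₁ + L c₂ = 0 := by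
      rw [← map_add, ← hc0]
      congr 1
      funext i
      by_cases h : i = k <;> simp [c₁, c₂, h]
    have hm := hext.2 (mem_valueSet_iff.2 ⟨_, hbox c₁ hc₁, rfl⟩)
      (mem_valueSet_iff.2 ⟨_, hbox c₂ hc₂, rfl⟩)
      ⟨1 / 2, 1 / 2, by norm_num, by norm_num, by norm_num, by
        rw [hval, hval, eq_neg_of_add_eq_zero_left hsum, Complex.real_smul, Complex.real_smul]
        push_cast
        ring⟩
    rw [hval, add_eq_left, hL, Finset.sum_eq_single k (by intro i _ hi'; simp [c₁, hi']) (by simp)]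
      at hm
    have hlt : lo k < hi k := lt_of_le_of_ne (hle k) fun h => hk (hc' k h)
    have hδ : δ k ≠ 0 := by
      simp only [δ]
      split_ifs
      · exact (sub_neg.2 hlt).ne
      · exact (sub_pos.2 hlt).ne'
    have : ((c₁ k * δ k : ℝ) : ℂ) ≠ 0 := by
      exact_mod_cast mul_ne_zero (by simpa [c₁] using hk) hδ
    exact mul_ne_zero this (pow_ne_zero _ hz) hm
  obtain ⟨l, u, hlu, hl⟩ := geometric_hahn_banach_point_closed
    (hSconv.linear_image L.toLinearMap) (hScompact.image L.continuous).isClosed h0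
  -- `δ i` has the sign opposite to `σ i`, hence the minus.
  refine ⟨-l, fun i hi' => ?_⟩
  have hmem : Pi.single i (1 : ℝ) ∈ S := by
    refine ⟨single_mem_stdSimplex ℝ i, fun j hj => ?_⟩
    have : j ≠ i := by rintro rfl; exact hi'.ne hj
    simp [this]
  have h1 := hl _ ⟨_, hmem, rfl⟩
  have h2 : L (Pi.single i 1) = δ i • z ^ (i : ℕ) := by
    rw [hL, Finset.sum_eq_single i (by intro j _ hj; simp [hj]) (by simp)]
    simp
  simp only [map_zero] at hlu
  have h3 : 0 < δ i * l (z ^ (i : ℕ)) := by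
    have := hlu.trans h1
    rw [ContinuousLinearMap.coe_coe, h2, map_smul] at this
    exact this
  simp only [δ] at h3
  simp only [neg_apply]
  split_ifs at h3 ⊢ <;> nlinarith

/-- Every angle is `(m - t)π/q` with `m` an integer and `0 ≤ t ≤ 1`. -/
lemma exists_angle_eq {q : ℕ} (hq : 0 < q) (β : ℝ) :
    ∃ (m : ℤ) (t : ℝ), 0 ≤ t ∧ t ≤ 1 ∧ β = (m - t) * Real.pi / q := by
  have hq' : (q : ℝ) ≠ 0 := by positivity
  refine ⟨⌈β * q / Real.pi⌉, ⌈β * q / Real.pi⌉ - β * q / Real.pi,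
    sub_nonneg.2 (Int.le_ceil _), ?_, ?_⟩
  · linarith [Int.ceil_lt_add_one (β * q / Real.pi)]
  · have := Real.pi_ne_zero
    field_simp
    ring

/-- Every critical vertex is read off the circle. -/
lemma exists_rotPattern_of_critical {n p q : ℕ} (hq : 0 < q) {lo hi : Fin (n + 1) → ℝ}
    (hle : ∀ i, lo i ≤ hi i) {f : ℝ[X]} (hf : f ∈ criticalVertices p q lo hi) :
    ∃ m : ℤ, vertexPoly lo hi (rotPattern n p q m) = f := by
  obtain ⟨⟨σ, rfl⟩, z, ⟨ρ, θ, hρ, hθ, rfl⟩, hext⟩ := hf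
  have hz : (ρ : ℂ) * Complex.exp (θ * Complex.I) ≠ 0 :=
    mul_ne_zero (by exact_mod_cast hρ.ne') (Complex.exp_ne_zero _)
  obtain ⟨l, hl⟩ := exists_functional_of_extreme hle σ hz hext
  obtain ⟨l', hl'⟩ : ∃ l' : ℂ →L[ℝ] ℝ, ∀ i : ℕ,
      l (((ρ : ℂ) * Complex.exp (θ * Complex.I)) ^ i) =
        l' (((ρ : ℂ) * Complex.exp ((p * Real.pi / q : ℝ) * Complex.I)) ^ i) := by
    rcases hθ with rfl | rfl
    · exact ⟨l, fun i => rfl⟩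
    -- Powers of points on the lower ray are conjugates of those on the upper ray.
    · refine ⟨l.comp Complex.conjCLE.toContinuousLinearMap, fun i => congrArg l ?_⟩
      simp [← Complex.exp_conj]
  obtain ⟨r, β, hr, hβ⟩ := exists_im_form l'
  obtain ⟨m, t, ht0, ht1, rfl⟩ := exists_angle_eq hq β
  refine ⟨m, ?_⟩
  rw [vertexPoly_eq, vertexPoly_eq]
  congr 1
  funext i
  rcases (hle i).lt_or_eq with hi' | hi'
  · have h := hl i hi'
    rw [hl', hβ, rotIm_exp] at h
    have e : (i : ℕ) * (p * Real.pi / q) - (m - t) * Real.pi / q =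
        ((((i : ℕ) * p - m : ℤ) : ℝ) + t) * Real.pi / q := by push_cast; ring
    rw [e] at h
    have hρi : 0 < ρ ^ (i : ℕ) := by positivity
    -- Weak sine signs suffice, also for `t` equal to 0 or 1, because `h` is strict.
    have key : rotPattern n p q m i = σ i := by
      unfold rotPattern
      by_cases hm : ((i : ℕ) * p - m : ℤ) % (2 * q) < q
      · have hs := mul_nonneg hr (mul_nonneg hρi.le (sin_nonneg_of_emod_lt hq ht0 ht1 hm))
        simp only [hm, decide_true]
        by_contra hσ
        rw [if_neg (Ne.symm hσ)] at h
        linarith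
      · have hs := mul_nonneg hr (mul_nonneg hρi.le
          (neg_nonneg.2 (sin_nonpos_of_not_emod_lt hq ht0 ht1 hm)))
        simp only [hm, decide_false]
        by_contra hσ
        rw [if_pos (by simpa using Ne.symm hσ)] at h
        linarith
    simp only [vertexCoeff, key]
  · simp only [vertexCoeff, hi', ite_self]

lemma range_eq_criticalVertices {n p q : ℕ} (hq : 0 < q) {lo hi : Fin (n + 1) → ℝ}
    (hle : ∀ i, lo i ≤ hi i) :
    Set.range (fun x : ZMod (2 * q) => vertexPoly lo hi (circlePattern n p q x)) =
      criticalVertices p q lo hi := by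
  rw [range_circlePattern hq (vertexPoly lo hi)]
  apply Set.Subset.antisymm
  · rintro _ ⟨m, rfl⟩
    exact rotPattern_mem_criticalVertices hq hle m
  · intro f hf
    exact exists_rotPattern_of_critical hq hle hf

/-! ### Counting the patterns -/

lemma vertexPoly_injective {n : ℕ} {lo hi : Fin (n + 1) → ℝ} (hlt : ∀ i, lo i < hi i) :
    Function.Injective (vertexPoly lo hi) := by
  intro σ τ h
  rw [vertexPoly_eq, vertexPoly_eq] at h
  funext i
  have h := congrFun (polyOf_injective h) i
  have := hlt i
  simp only [vertexCoeff] at h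
  cases hσ : σ i <;> cases hτ : τ i <;> simp [hσ, hτ] at h ⊢ <;> linarith

lemma rotPattern_add_period (n p q : ℕ) (m k : ℤ) :
    rotPattern n p q (m + 2 * q * k) = rotPattern n p q m := by
  funext i
  unfold rotPattern
  have : ((i : ℕ) * p - (m + 2 * q * k) : ℤ) = (i : ℕ) * p - m + 2 * q * (-k) := by ring
  rw [this, Int.add_mul_emod_self_left]

/-- The pattern changes at most when the half circle passes one of the positions read. -/
lemma rotPattern_succ {n p q : ℕ} (hq : 0 < q) {m : ℤ}
    (h : ∀ i : Fin (n + 1), ¬ (q : ℤ) ∣ (i : ℕ) * p - m) :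
    rotPattern n p q (m + 1) = rotPattern n p q m := by
  funext i
  unfold rotPattern
  have hi := h i
  rw [decide_eq_decide]
  have e : ((i : ℕ) * p - (m + 1) : ℤ) = ((i : ℕ) * p - m) - 1 := by ring
  rw [e]
  generalize ((i : ℕ) * p - m : ℤ) = k at hi
  have h1 := Int.emod_add_mul_ediv k (2 * q)
  have h2 := Int.emod_nonneg k (show (2 * q : ℤ) ≠ 0 by positivity)
  have h3 := Int.emod_lt_of_pos k (show (0 : ℤ) < 2 * q by positivity)
  have h4 : k % (2 * q) ≠ 0 := by
    intro h; rw [h] at h1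
    exact hi ⟨2 * (k / (2 * q)), by linear_combination -h1⟩
  have h5 : k % (2 * q) ≠ q := by
    intro h; rw [h] at h1
    exact hi ⟨1 + 2 * (k / (2 * q)), by linear_combination -h1⟩
  have h6 : (k - 1) % (2 * q) = k % (2 * q) - 1 := by
    rw [← Int.emod_eq_of_lt (a := k % (2 * q) - 1) (b := 2 * q) (by omega) (by omega)]
    simp
  rw [h6]
  omega

/-- After passing a position that is read, the pattern stays different for half a turn. -/
lemma rotPattern_add_ne {n p q : ℕ} (hq : 0 < q) {m d : ℤ} (i : Fin (n + 1))
    (h : (q : ℤ) ∣ (i : ℕ) * p - m) (hd : 0 < d) (hdq : d ≤ q) :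
    rotPattern n p q (m + d) ≠ rotPattern n p q m := by
  intro he
  have := congrFun he i
  unfold rotPattern at this
  rw [decide_eq_decide] at this
  have e : ((i : ℕ) * p - (m + d) : ℤ) = ((i : ℕ) * p - m) - d := by ring
  rw [e] at this
  obtain ⟨c, hc⟩ := h
  rw [hc] at this
  rcases Int.even_or_odd' c with ⟨b, rfl | rfl⟩
  · have e1 : (q * (2 * b) : ℤ) % (2 * q) = 0 := by
      rw [show (q * (2 * b) : ℤ) = 2 * q * b by ring]; simp
    have e2 : (q * (2 * b) - d : ℤ) % (2 * q) = 2 * q - d := by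
      rw [show (q * (2 * b) - d : ℤ) = (2 * q - d) + 2 * q * (b - 1) by ring,
        Int.add_mul_emod_self_left, Int.emod_eq_of_lt (by omega) (by omega)]
    rw [e1, e2] at this
    omega
  · have e1 : (q * (2 * b + 1) : ℤ) % (2 * q) = q := by
      rw [show (q * (2 * b + 1) : ℤ) = q + 2 * q * b by ring, Int.add_mul_emod_self_left,
        Int.emod_eq_of_lt (by omega) (by omega)]
    have e2 : (q * (2 * b + 1) - d : ℤ) % (2 * q) = q - d := by
      rw [show (q * (2 * b + 1) - d : ℤ) = (q - d) + 2 * q * b by ring,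
        Int.add_mul_emod_self_left, Int.emod_eq_of_lt (by omega) (by omega)]
    rw [e1, e2] at this
    omega

/-- Representatives modulo `2q` of the rotations at which the pattern changes. -/
def breakpoints (n p q : ℕ) : Finset ℤ :=
  (Finset.range (min q (n + 1)) ×ˢ Finset.range 2).image
    fun x => ((x.1 * p % q + x.2 * q : ℕ) : ℤ)

/-- Coprimality makes the residues ip mod q distinct for i < q, and each has two lifts modulo 2q. -/
lemma card_breakpoints {n p q : ℕ} (hq : 0 < q) (hpq : Nat.Coprime p q) :
    (breakpoints n p q).card = 2 * min q (n + 1) := by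
  unfold breakpoints
  rw [Finset.card_image_of_injOn, Finset.card_product, Finset.card_range, Finset.card_range,
    mul_comm]
  rintro ⟨i, e⟩ hx ⟨j, f⟩ hy hxy
  simp only [Finset.coe_product, Finset.coe_range, Set.mem_prod, Set.mem_Iio, lt_min_iff] at hx hy
  have hxy : i * p % q + e * q = j * p % q + f * q := Nat.cast_injective (R := ℤ) hxy
  have h1 : i * p % q = j * p % q := by
    have := congrArg (· % q) hxy
    simpa using this
  have h2 : i ≡ j [MOD q] :=
    Nat.ModEq.cancel_right_of_coprime (by rwa [Nat.gcd_comm]) h1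
  have h3 : i = j := Nat.ModEq.eq_of_lt_of_lt h2 hx.1.1 hy.1.1
  have h4 : e = f := by
    rw [h1] at hxy
    exact Nat.eq_of_mul_eq_mul_right hq (Nat.add_left_cancel hxy)
  rw [h3, h4]

/-- An index i ≥ q repeats the residue of i mod q, so q caps the count. -/
lemma mem_breakpoints {n p q : ℕ} (hq : 0 < q) {m : ℤ} :
    m ∈ breakpoints n p q ↔
      (0 ≤ m ∧ m < 2 * q) ∧ ∃ i : Fin (n + 1), (q : ℤ) ∣ (i : ℕ) * p - m := by
  simp only [breakpoints, Finset.mem_image, Finset.mem_product, Finset.mem_range, Prod.exists,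
    lt_min_iff]
  constructor
  · rintro ⟨i, e, ⟨⟨_, hi⟩, he⟩, rfl⟩
    have h := Nat.mod_lt (i * p) hq
    refine ⟨⟨by positivity, ?_⟩, ⟨i, hi⟩, ⟨(i * p / q : ℕ) - e, ?_⟩⟩
    · have : i * p % q + e * q < 2 * q := by interval_cases e <;> omega
      exact_mod_cast this
    · have h1 : ((i * p % q : ℕ) : ℤ) + q * (i * p / q : ℕ) = i * p := by
        exact_mod_cast Nat.mod_add_div (i * p) q
      push_cast at h1 ⊢
      linear_combination -h1
  · rintro ⟨⟨h0, h1⟩, i, hi⟩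
    lift m to ℕ using h0
    have h1 : m < 2 * q := by exact_mod_cast h1
    have hmod : m % q = (i : ℕ) * p % q :=
      (Nat.modEq_iff_dvd (n := q) (a := m) (b := (i : ℕ) * p)).2 (by exact_mod_cast hi)
    refine ⟨(i : ℕ) % q, m / q, ⟨⟨Nat.mod_lt _ hq, ?_⟩, ?_⟩, ?_⟩
    · exact (Nat.mod_le _ _).trans_lt i.2
    · exact (Nat.div_lt_iff_lt_mul hq).2 h1
    · rw [Nat.mod_mul_mod, ← hmod, mul_comm (m / q), Nat.mod_add_div]

lemma rotPattern_injOn {n p q : ℕ} (hq : 0 < q) :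
    Set.InjOn (rotPattern n p q) (breakpoints n p q) := by
  have key : ∀ m ∈ breakpoints n p q, ∀ m' ∈ breakpoints n p q, m < m' →
      rotPattern n p q m' ≠ rotPattern n p q m := by
    intro m hm m' hm' hlt
    obtain ⟨⟨h0, h1⟩, i, hi⟩ := (mem_breakpoints hq).1 hm
    obtain ⟨⟨h0', h1'⟩, i', hi'⟩ := (mem_breakpoints hq).1 hm'
    rcases le_or_gt (m' - m) q with hle | hgt
    · have := rotPattern_add_ne hq i hi (sub_pos.2 hlt) hle
      rwa [add_sub_cancel] at this
    -- Beyond half a turn, go round the other way, from `m'` to `m + 2q`.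
    · have := rotPattern_add_ne hq i' hi' (d := m + 2 * q * 1 - m') (by omega) (by omega)
      rw [add_sub_cancel, rotPattern_add_period] at this
      exact this.symm
  intro m hm m' hm' h
  rcases lt_trichotomy m m' with hlt | heq | hgt
  · exact absurd h.symm (key m hm m' hm' hlt)
  · exact heq
  · exact absurd h (key m' hm' m hm hgt)

/-- Increasing m leaves the pattern unchanged until a breakpoint is met; one is met at the latest at
a multiple of q, where the index 0 supplies it. -/
lemma exists_breakpoint {n p q : ℕ} (hq : 0 < q) (m : ℤ) :
    ∃ m' ∈ breakpoints n p q, rotPattern n p q m' = rotPattern n p q m := by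
  have key : ∀ (k : ℕ) (m : ℤ), (q : ℤ) ∣ m + k →
      ∃ m' : ℤ, (∃ i : Fin (n + 1), (q : ℤ) ∣ (i : ℕ) * p - m') ∧
        rotPattern n p q m' = rotPattern n p q m := by
    intro k
    induction k with
    | zero =>
      intro m hm
      exact ⟨m, ⟨0, by simpa using hm⟩, rfl⟩
    | succ k ih =>
      intro m hm
      by_cases h : ∃ i : Fin (n + 1), (q : ℤ) ∣ (i : ℕ) * p - m
      · exact ⟨m, h, rfl⟩
      · obtain ⟨m', h1, h2⟩ := ih (m + 1) (by convert hm using 1; push_cast; ring)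
        exact ⟨m', h1, h2.trans (rotPattern_succ hq (not_exists.1 h))⟩
  obtain ⟨m', ⟨i, hi⟩, h⟩ := key ((-m) % q).toNat m (by
    rw [Int.toNat_of_nonneg (Int.emod_nonneg _ (by positivity))]
    exact ⟨-(-m / q), by linear_combination Int.emod_add_mul_ediv (-m) q⟩)
  have e := Int.emod_add_mul_ediv m' (2 * q)
  refine ⟨m' % (2 * q), (mem_breakpoints hq).2 ⟨⟨Int.emod_nonneg _ (by positivity),
    Int.emod_lt_of_pos _ (by positivity)⟩, i, ?_⟩, ?_⟩
  · have : ((i : ℕ) * p - m' % (2 * q) : ℤ) = ((i : ℕ) * p - m') + q * (2 * (m' / (2 * q))) := by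
      linear_combination -e
    rw [this]
    exact dvd_add hi (dvd_mul_right _ _)
  · rw [← h, ← rotPattern_add_period n p q (m' % (2 * q)) (m' / (2 * q)), e]

lemma ncard_range_circlePattern {n p q : ℕ} (hq : 0 < q) (hpq : Nat.Coprime p q) :
    (Set.range (circlePattern n p q)).ncard = 2 * min q (n + 1) := by
  have h : Set.range (circlePattern n p q) = rotPattern n p q '' (breakpoints n p q) := by
    have := range_circlePattern (n := n) (p := p) hq (fun σ => σ)
    rw [show Set.range (circlePattern n p q) = _ from this]
    apply Set.Subset.antisymm
    · rintro _ ⟨m, rfl⟩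
      obtain ⟨m', h1, h2⟩ := exists_breakpoint (n := n) (p := p) hq m
      exact ⟨m', h1, h2⟩
    · rintro _ ⟨m, _, rfl⟩
      exact ⟨m, rfl⟩
  rw [h, (rotPattern_injOn hq).ncard_image, Set.ncard_coe_finset,
    card_breakpoints hq hpq]

lemma circlePattern_range_eq_and_ncard {n p q : ℕ} (hq : 0 < q) (hpq : Nat.Coprime p q)
    {lo hi : Fin (n + 1) → ℝ} (hlt : ∀ i, lo i < hi i) :
    Set.range (circlePattern n p q) =
        {σ | vertexPoly lo hi σ ∈ criticalVertices p q lo hi} ∧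
      (criticalVertices p q lo hi).ncard = 2 * min q (n + 1) := by
  have h : criticalVertices p q lo hi = vertexPoly lo hi '' Set.range (circlePattern n p q) := by
    rw [← range_eq_criticalVertices hq fun i => (hlt i).le, ← Set.range_comp]
    rfl
  constructor
  · rw [h]
    exact (Set.preimage_image_eq _ (vertexPoly_injective hlt)).symm
  · rw [h, Set.ncard_image_of_injective _ (vertexPoly_injective hlt),
      ncard_range_circlePattern hq hpq]

/-! ### Geometry of the sector and growth of the phase -/

section Sector

variable {p q : ℕ}

lemma half_pi_le_angle (hhalf : (1 / 2 : ℝ) ≤ (p : ℝ) / q) : Real.pi / 2 ≤ p * Real.pi / q := by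
  have := Real.pi_pos
  rw [mul_div_right_comm]
  nlinarith

lemma angle_lt_pi (hone : (p : ℝ) / q < 1) : p * Real.pi / q < Real.pi := by
  have := Real.pi_pos
  rw [mul_div_right_comm]
  nlinarith

/-- As φ ≥ π/2, the opening 2π - 2φ is at most π: a point of the sector is less than half a turn
past the upper ray. -/
lemma rotIm_pos_of_mem_sector (hhalf : (1 / 2 : ℝ) ≤ (p : ℝ) / q) {z : ℂ} (hz : z ∈ sector p q) :
    0 < rotIm (p * Real.pi / q) z := by
  obtain ⟨ρ, θ, hρ, h1, h2, rfl⟩ := hz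
  have h := rotIm_exp (p * Real.pi / q) ρ θ 1
  rw [pow_one, pow_one] at h
  rw [h]
  have := half_pi_le_angle hhalf
  push_cast
  exact mul_pos hρ (Real.sin_pos_of_pos_of_lt_pi (by linarith) (by linarith))

/-- Makes the sector the negativity set of a continuous function, as the continuation argument
needs. -/
lemma mem_sector_iff (hhalf : (1 / 2 : ℝ) ≤ (p : ℝ) / q) (hone : (p : ℝ) / q < 1) {z : ℂ} :
    z ∈ sector p q ↔ z.re < ‖z‖ * Real.cos (p * Real.pi / q) := by
  have hφ := half_pi_le_angle hhalf
  have hφ' := angle_lt_pi hone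
  have hpi := Real.pi_pos
  constructor
  · rintro ⟨ρ, θ, hρ, h1, h2, rfl⟩
    rw [Complex.re_ofReal_mul, norm_mul, Complex.norm_exp_ofReal_mul_I, Complex.norm_real,
      Real.norm_of_nonneg hρ.le, mul_one, Complex.exp_ofReal_mul_I_re]
    refine mul_lt_mul_of_pos_left ?_ hρ
    rcases le_or_gt θ Real.pi with h | h
    · exact Real.cos_lt_cos_of_nonneg_of_le_pi (by linarith) h h1
    · rw [← Real.cos_two_pi_sub θ]
      exact Real.cos_lt_cos_of_nonneg_of_le_pi (by linarith) (by linarith) (by linarith)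
  · intro h
    have hz : z ≠ 0 := by rintro rfl; simp at h
    have hn : 0 < ‖z‖ := norm_pos_iff.2 hz
    have hre : z.re = ‖z‖ * Real.cos z.arg := (Complex.norm_mul_cos_arg z).symm
    rw [hre, ← Real.cos_abs] at h
    have h := lt_of_mul_lt_mul_left h hn.le
    have harg : p * Real.pi / q < |z.arg| := by
      by_contra! hc
      exact absurd (Real.cos_le_cos_of_nonneg_of_le_pi (abs_nonneg _) hφ'.le hc) (not_le.2 h)
    rcases le_or_gt 0 z.arg with h0 | h0
    · rw [abs_of_nonneg h0] at harg
      exact ⟨‖z‖, z.arg, hn, harg, by linarith [Complex.arg_le_pi z],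
        (Complex.norm_mul_exp_arg_mul_I z).symm⟩
    · rw [abs_of_neg h0] at harg
      refine ⟨‖z‖, z.arg + 2 * Real.pi, hn, by linarith [Complex.neg_pi_lt_arg z], by linarith, ?_⟩
      push_cast
      rw [add_mul, Complex.exp_add, Complex.exp_two_pi_mul_I, mul_one,
        Complex.norm_mul_exp_arg_mul_I]

lemma mem_boundaryRays_of_re_eq (hhalf : (1 / 2 : ℝ) ≤ (p : ℝ) / q) (hone : (p : ℝ) / q < 1)
    {z : ℂ} (hz : z ≠ 0) (h : z.re = ‖z‖ * Real.cos (p * Real.pi / q)) :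
    z ∈ boundaryRays p q := by
  have hφ := half_pi_le_angle hhalf
  have hφ' := angle_lt_pi hone
  have hpi := Real.pi_pos
  have hn : 0 < ‖z‖ := norm_pos_iff.2 hz
  rw [← Complex.norm_mul_cos_arg z, ← Real.cos_abs] at h
  have h := Real.injOn_cos ⟨abs_nonneg _, Complex.abs_arg_le_pi z⟩
    ⟨by linarith, hφ'.le⟩ (mul_left_cancel₀ hn.ne' h)
  exact ⟨‖z‖, z.arg, hn, eq_or_eq_neg_of_abs_eq h, (Complex.norm_mul_exp_arg_mul_I z).symm⟩

lemma boundary_notMem_sector (hhalf : (1 / 2 : ℝ) ≤ (p : ℝ) / q) (hone : (p : ℝ) / q < 1)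
    {ρ : ℝ} (hρ : 0 ≤ ρ) :
    (ρ : ℂ) * Complex.exp ((p * Real.pi / q : ℝ) * Complex.I) ∉ sector p q := by
  rw [mem_sector_iff hhalf hone, Complex.re_ofReal_mul, norm_mul, Complex.norm_exp_ofReal_mul_I,
    Complex.norm_real, Real.norm_of_nonneg hρ, mul_one, Complex.exp_ofReal_mul_I_re]
  exact lt_irrefl _

/-- On the upper boundary ray the phase of a stable polynomial increases. -/
lemma im_logDeriv_pos (hhalf : (1 / 2 : ℝ) ≤ (p : ℝ) / q) (hone : (p : ℝ) / q < 1) {f : ℝ[X]}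
    (hdeg : 0 < f.natDegree) (hf : SectorStable p q f) {ρ : ℝ} (hρ : 0 < ρ) {z : ℂ}
    (hz : z = (ρ : ℂ) * Complex.exp ((p * Real.pi / q : ℝ) * Complex.I)) :
    0 < (z * aeval z (derivative f) / aeval z f).im := by
  have hf0 : f ≠ 0 := by rintro rfl; simp at hdeg
  set F : ℂ[X] := f.map (algebraMap ℝ ℂ) with hF
  have hF0 : F ≠ 0 := (Polynomial.map_ne_zero_iff (algebraMap ℝ ℂ).injective).2 hf0
  have hev : F.eval z ≠ 0 := by
    rw [hF, eval_map_algebraMap]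
    intro h
    have := hf z h
    rw [hz] at this
    exact boundary_notMem_sector hhalf hone hρ.le this
  have e1 : aeval z f = F.eval z := (eval_map_algebraMap f z).symm
  have e2 : aeval z (derivative f) = F.derivative.eval z := by
    rw [hF, derivative_map, eval_map_algebraMap]
  -- Each root contributes Im(z/(z - r)) = Im(z̄r)/|z - r|², positive since r is less than half a
  -- turn past z.
  have hterm : ∀ r ∈ F.roots, 0 < (z * (1 / (z - r))).im := by
    intro r hr
    have hr0 : aeval r f = 0 := by
      rw [← eval_map_algebraMap]; exact (mem_roots hF0).1 hr
    have hrs := rotIm_pos_of_mem_sector hhalf (hf r hr0)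
    have hzr : z - r ≠ 0 := by
      intro h
      rw [sub_eq_zero.1 h] at hev
      exact hev ((mem_roots hF0).1 hr)
    have hnn : 0 < Complex.normSq (z - r) := Complex.normSq_pos.2 hzr
    have hz' : (starRingEnd ℂ) z =
        (ρ : ℂ) * Complex.exp (-((p * Real.pi / q : ℝ) : ℂ) * Complex.I) := by
      rw [hz, map_mul, Complex.conj_ofReal, ← Complex.exp_conj]
      simp
    have h1 : 0 < ((starRingEnd ℂ) z * r).im := by
      rw [hz', mul_assoc, Complex.im_ofReal_mul]
      exact mul_pos hρ hrs
    have h2 : (z * (1 / (z - r))).im =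
        ((starRingEnd ℂ) z * r).im / Complex.normSq (z - r) := by
      rw [mul_one_div, Complex.div_im, ← sub_div]
      congr 1
      simp
      ring
    rw [h2]
    positivity
  rw [e1, e2, mul_div_assoc,
    (IsAlgClosed.splits F).eval_derivative_div_eval_of_ne_zero hev]
  have hsum : ∀ s : Multiset ℂ, (∀ r ∈ s, 0 < (z * (1 / (z - r))).im) → s ≠ 0 →
      0 < (z * (s.map fun r => 1 / (z - r)).sum).im := by
    intro s
    induction s using Multiset.induction_on with
    | empty => simp
    | cons a s ih =>
      intro h _
      rw [Multiset.map_cons, Multiset.sum_cons, mul_add, Complex.add_im]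
      have ha := h a (Multiset.mem_cons_self a s)
      by_cases hs : s = 0
      · simpa [hs] using ha
      · exact add_pos ha (ih (fun r hr => h r (Multiset.mem_cons_of_mem hr)) hs)
  refine hsum _ hterm ((IsAlgClosed.splits F).roots_ne_zero ?_)
  rw [hF, natDegree_map]
  exact hdeg.ne'

end Sector

/-! ### Degree and extreme coefficients -/

section Degree

variable {n : ℕ} {a : Fin (n + 1) → ℝ}

lemma natDegree_polyOf (ha : a (Fin.last n) ≠ 0) : (polyOf a).natDegree = n := by
  refine natDegree_eq_of_le_of_coeff_ne_zero ?_ ?_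
  · exact natDegree_sum_le_of_forall_le _ _ fun i _ =>
      (natDegree_C_mul_X_pow_le _ _).trans (Nat.lt_succ_iff.1 i.2)
  · have := coeff_polyOf a (Fin.last n)
    rw [Fin.val_last] at this
    rwa [this]

lemma leadingCoeff_polyOf (ha : a (Fin.last n) ≠ 0) :
    (polyOf a).leadingCoeff = a (Fin.last n) := by
  have := coeff_polyOf a (Fin.last n)
  rw [Fin.val_last] at this
  rw [leadingCoeff, natDegree_polyOf ha, this]

/-- z d/dz is ρ d/dρ along a ray and only rescales coefficients, so the same sines govern f and its
radial velocity. -/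
lemma mul_aeval_derivative_polyOf (a : Fin (n + 1) → ℝ) (z : ℂ) :
    z * aeval z (derivative (polyOf a)) =
      aeval z (polyOf fun i : Fin (n + 1) => (i : ℕ) * a i) := by
  rw [aeval_polyOf]
  simp only [polyOf, map_sum, derivative_C_mul_X_pow, map_mul, aeval_C, aeval_X_pow,
    Complex.coe_algebraMap, Finset.mul_sum]
  refine Finset.sum_congr rfl fun i _ => ?_
  rcases Nat.eq_zero_or_pos (i : ℕ) with h | h
  · simp [h]
  · conv_rhs => rw [← Nat.sub_add_cancel h, pow_succ]
    push_cast [Nat.cast_sub h]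
    ring

lemma aeval_zero_polyOf (a : Fin (n + 1) → ℝ) : aeval (0 : ℂ) (polyOf a) = a 0 := by
  rw [aeval_polyOf, Finset.sum_eq_single 0]
  · simp
  · intro i _ hi
    have : (i : ℕ) ≠ 0 := fun h => hi (Fin.ext h)
    simp [this]
  · simp

/-- The extreme coefficients of a stable polynomial have the same sign. -/
lemma coeff_zero_mul_last_pos {p q : ℕ} (hhalf : (1 / 2 : ℝ) ≤ (p : ℝ) / q)
    (hone : (p : ℝ) / q < 1) (ha : a (Fin.last n) ≠ 0) (hs : SectorStable p q (polyOf a)) :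
    0 < a (Fin.last n) * a 0 := by
  rcases Nat.eq_zero_or_pos n with rfl | hn
  · have : Fin.last 0 = 0 := rfl
    rw [this] at ha ⊢
    exact mul_self_pos.2 ha
  -- Scaling by the leading coefficient makes `P` tend to +∞; a nonpositive value at 0 would give a
  -- root on [0, ∞), outside the sector.
  set P : ℝ[X] := C (a (Fin.last n)) * polyOf a with hP
  have hroot : ∀ x : ℝ, 0 ≤ x → P.eval x ≠ 0 := by
    intro x hx h
    rw [hP, eval_mul, eval_C, mul_eq_zero, or_iff_right ha] at h
    have h1 : aeval (x : ℂ) (polyOf a) = 0 := by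
      have := aeval_algebraMap_apply ℂ x (polyOf a)
      rw [Complex.coe_algebraMap] at this
      rw [this, coe_aeval_eq_eval, h]
      simp
    have h2 := (mem_sector_iff hhalf hone).1 (hs _ h1)
    rw [Complex.ofReal_re, Complex.norm_real, Real.norm_of_nonneg hx] at h2
    have := Real.cos_nonpos_of_pi_div_two_le_of_le (half_pi_le_angle hhalf)
      (by linarith [angle_lt_pi hone, Real.pi_pos])
    nlinarith
  have h0 : P.eval 0 = a (Fin.last n) * a 0 := by
    rw [hP, eval_mul, eval_C, ← coeff_zero_eq_eval_zero]
    exact congrArg _ (coeff_polyOf a 0)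
  rw [← h0]
  by_contra! hneg
  have hlead : P.leadingCoeff = a (Fin.last n) * a (Fin.last n) := by
    rw [hP, leadingCoeff_mul, leadingCoeff_C, leadingCoeff_polyOf ha]
  have hdeg : 0 < P.degree := by
    rw [hP, degree_C_mul ha]
    exact natDegree_pos_iff_degree_pos.1 (by rwa [natDegree_polyOf ha])
  have hlim := P.tendsto_atTop_of_leadingCoeff_nonneg hdeg (by rw [hlead]; exact mul_self_nonneg _)
  obtain ⟨x, hx0, hx⟩ := ((Filter.eventually_ge_atTop (0 : ℝ)).and
    (hlim.eventually_ge_atTop 0)).exists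
  obtain ⟨y, hy, hy0⟩ := intermediate_value_Icc hx0 P.continuous.continuousOn ⟨hneg, hx⟩
  exact hroot y hy.1 hy0

end Degree

lemma rotIm_sub_angle (β γ : ℝ) (w : ℂ) :
    rotIm (β - γ) w =
      Real.sin γ * (Complex.exp (-(β : ℂ) * Complex.I) * w).re + Real.cos γ * rotIm β w := by
  have : -((β - γ : ℝ) : ℂ) * Complex.I = (γ : ℂ) * Complex.I + -(β : ℂ) * Complex.I := by
    push_cast; ring
  rw [rotIm, this, Complex.exp_add, mul_assoc, Complex.mul_im, Complex.exp_ofReal_mul_I_re,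
    Complex.exp_ofReal_mul_I_im, rotIm]
  ring

lemma rotIm_add_two_pi_mul (β : ℝ) (k : ℤ) (w : ℂ) :
    rotIm (β + k * (2 * Real.pi)) w = rotIm β w := by
  have : β + k * (2 * Real.pi) = β - (-k : ℤ) * (2 * Real.pi) := by push_cast; ring
  rw [this, rotIm_sub_angle, Real.cos_int_mul_two_pi, ← sub_zero ((-k : ℤ) * (2 * Real.pi)),
    Real.sin_int_mul_two_pi_sub]
  simp

/-! ### Zero exclusion along the upper ray -/

section Ray

variable {n p q : ℕ} {lo hi : Fin (n + 1) → ℝ}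

/-- The support function of the value set at `ρ e^{jpπ/q}` in the `m`-th edge direction. -/
noncomputable def support (p q : ℕ) (lo hi : Fin (n + 1) → ℝ) (m : ℤ) (ρ : ℝ) : ℝ :=
  rotIm (m * Real.pi / q)
    (aeval ((ρ : ℂ) * Complex.exp ((p * Real.pi / q : ℝ) * Complex.I))
      (vertexPoly lo hi (rotPattern n p q m)))

lemma continuous_support (m : ℤ) : Continuous (support p q lo hi m) := by
  unfold support
  simp only [vertexPoly_eq, rotIm_aeval]
  fun_prop

lemma support_add_period (hq : 0 < q) (m k : ℤ) (ρ : ℝ) :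
    support p q lo hi (m + 2 * q * k) ρ = support p q lo hi m ρ := by
  have hq' : (q : ℝ) ≠ 0 := by positivity
  unfold support
  have : ((m + 2 * q * k : ℤ) : ℝ) * Real.pi / q = m * Real.pi / q + k * (2 * Real.pi) := by
    push_cast
    field_simp
  rw [rotPattern_add_period, this, rotIm_add_two_pi_mul]

lemma support_emod (hq : 0 < q) (m : ℤ) (ρ : ℝ) :
    support p q lo hi (m % (2 * q)) ρ = support p q lo hi m ρ := by
  conv_rhs => rw [← Int.emod_add_mul_ediv m (2 * q)]
  rw [support_add_period hq]

lemma sin_pi_div_pos (hq : 2 ≤ q) : 0 < Real.sin (Real.pi / q) := by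
  have hq' : (2 : ℝ) ≤ q := by exact_mod_cast hq
  have := Real.pi_pos
  apply Real.sin_pos_of_pos_of_lt_pi (by positivity)
  rw [div_lt_iff₀ (by linarith)]
  nlinarith

lemma exists_valueSet_eq_image (lo hi : Fin (n + 1) → ℝ) (z : ℂ) :
    ∃ L : (Fin (n + 1) → ℝ) →L[ℝ] ℂ, valueSet lo hi z = L '' Set.Icc lo hi := by
  refine ⟨∑ i : Fin (n + 1),
    (ContinuousLinearMap.proj (R := ℝ) (φ := fun _ : Fin (n + 1) => ℝ) i).smulRight
      (z ^ (i : ℕ)), ?_⟩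
  ext w
  rw [mem_valueSet_iff]
  constructor
  · rintro ⟨a, ha, rfl⟩
    exact ⟨a, ⟨fun i => (ha i).1, fun i => (ha i).2⟩, by simp [aeval_polyOf]⟩
  · rintro ⟨a, ha, rfl⟩
    exact ⟨a, fun i => ⟨ha.1 i, ha.2 i⟩, by simp [aeval_polyOf]⟩

/-- A point outside the value set violates one of the edge inequalities. -/
lemma exists_support_neg (hq : 2 ≤ q) (hle : ∀ i, lo i ≤ hi i) {ρ : ℝ} (hρ : 0 ≤ ρ)
    (h0 : (0 : ℂ) ∉ valueSet lo hi
      ((ρ : ℂ) * Complex.exp ((p * Real.pi / q : ℝ) * Complex.I))) :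
    ∃ m : ℤ, support p q lo hi m ρ < 0 := by
  have hq0 : 0 < q := by omega
  by_contra! hall
  obtain ⟨L, hL⟩ := exists_valueSet_eq_image lo hi
    ((ρ : ℂ) * Complex.exp ((p * Real.pi / q : ℝ) * Complex.I))
  have hconv : Convex ℝ (L '' Set.Icc lo hi) := (convex_Icc lo hi).linear_image L.toLinearMap
  have hcl : IsClosed (L '' Set.Icc lo hi) := (isCompact_Icc.image L.continuous).isClosed
  rw [← hL] at hconv hcl
  obtain ⟨l, u, hl, hu⟩ := geometric_hahn_banach_closed_point hconv hcl h0
  obtain ⟨r, β, hr, hβ⟩ := exists_im_form l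
  obtain ⟨m, t, ht0, ht1, rfl⟩ := exists_angle_eq hq0 β
  set w := aeval ((ρ : ℂ) * Complex.exp ((p * Real.pi / q : ℝ) * Complex.I))
    (vertexPoly lo hi (rotPattern n p q m)) with hw
  have hwneg : r * rotIm ((m - t) * Real.pi / q) w < 0 := by
    rw [← hβ]
    have h1 := hl w (mem_valueSet_iff.2 ⟨_, vertexCoeff_mem hle _, rfl⟩)
    rw [map_zero] at hu
    exact h1.trans hu
  have hpos : 0 ≤ rotIm (m * Real.pi / q) w := hall m
  -- `w` also maximizes in direction (m - 1)π/q, the case t = 1.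
  have hpos' : 0 ≤ rotIm (m * Real.pi / q - Real.pi / q) w := by
    have h1 := rotIm_le_rotPattern (p := p) hq0
      (vertexCoeff_mem hle (rotPattern n p q (m - 1))) (t := 1) zero_le_one le_rfl m hρ
    have h2 := hall (m - 1)
    have e : (((m - 1 : ℤ) : ℝ)) * Real.pi / q = (m - 1) * Real.pi / q := by push_cast; rfl
    have e' : m * Real.pi / q - Real.pi / q = (m - 1) * Real.pi / q := by ring
    rw [support, e] at h2
    rw [e']
    exact h2.trans h1
  have e : ((m : ℝ) - t) * Real.pi / q = m * Real.pi / q - t * (Real.pi / q) := by ring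
  have hpi : 0 ≤ Real.pi / q := by positivity
  have hle_pi : Real.pi / q ≤ Real.pi :=
    div_le_self Real.pi_pos.le (by exact_mod_cast hq0)
  have hsin := sin_pi_div_pos hq
  have h1 : 0 ≤ Real.sin (t * (Real.pi / q)) :=
    Real.sin_nonneg_of_nonneg_of_le_pi (by positivity) (by nlinarith)
  have h2 : 0 ≤ Real.sin (Real.pi / q - t * (Real.pi / q)) :=
    Real.sin_nonneg_of_nonneg_of_le_pi (by nlinarith) (by nlinarith)
  rw [rotIm_sub_angle] at hpos'
  rw [e, rotIm_sub_angle] at hwneg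
  rw [Real.sin_sub] at h2
  set R := (Complex.exp (-((m * Real.pi / q : ℝ) : ℂ) * Complex.I) * w).re
  set I := rotIm (m * Real.pi / q) w
  -- The functional at (m - t)π/q, times sin(π/q), combines those at (m - 1)π/q and mπ/q with
  -- weights sin(tπ/q) and sin((1 - t)π/q), both nonnegative.
  have hfin : 0 ≤ Real.sin (Real.pi / q) *
      (Real.sin (t * (Real.pi / q)) * R + Real.cos (t * (Real.pi / q)) * I) := by
    have := add_nonneg (mul_nonneg h1 hpos') (mul_nonneg h2 hpos)
    linarith
  have := nonneg_of_mul_nonneg_right hfin hsin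
  nlinarith

/-- A stable vertex whose value lies on the line through `0` in direction `e^{jβ}` crosses that
line in the direction determined by the side of `0` on which it lies. -/
lemma rotIm_derivative_sign (hhalf : (1 / 2 : ℝ) ≤ (p : ℝ) / q) (hone : (p : ℝ) / q < 1)
    {f : ℝ[X]} (hdeg : 0 < f.natDegree) (hf : SectorStable p q f) {ρ : ℝ} (hρ : 0 < ρ) {z : ℂ}
    (hz : z = (ρ : ℂ) * Complex.exp ((p * Real.pi / q : ℝ) * Complex.I)) {β : ℝ}
    (him : rotIm β (aeval z f) = 0) :
    0 < (Complex.exp (-(β : ℂ) * Complex.I) * aeval z f).re *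
      rotIm β (z * aeval z (derivative f)) := by
  have hne : aeval z f ≠ 0 := by
    intro h
    have := hf z h
    rw [hz] at this
    exact boundary_notMem_sector hhalf hone hρ.le this
  have hpos := im_logDeriv_pos hhalf hone hdeg hf hρ hz
  set u := Complex.exp (-(β : ℂ) * Complex.I) * aeval z f with hu
  have hu0 : u ≠ 0 := mul_ne_zero (Complex.exp_ne_zero _) hne
  have him' : u.im = 0 := him
  have hre : u.re ≠ 0 := fun h => hu0 (Complex.ext h him')
  have e : rotIm β (z * aeval z (derivative f)) =
      (u * (z * aeval z (derivative f) / aeval z f)).im := by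
    rw [rotIm, hu]
    congr 1
    field_simp
  rw [e, Complex.mul_im, him', zero_mul, add_zero, ← mul_assoc]
  exact mul_pos (mul_self_pos.2 hre) hpos

/-- If the vertices are stable and `0` lies in the value set, then it lies off all its edges. -/
lemma support_pos_of_zero_mem (hq : 2 ≤ q) (hhalf : (1 / 2 : ℝ) ≤ (p : ℝ) / q)
    (hone : (p : ℝ) / q < 1) (hle : ∀ i, lo i ≤ hi i)
    (h0 : (0 : ℝ) ∉ Set.Icc (lo (Fin.last n)) (hi (Fin.last n)))
    (hst : ∀ m : ℤ, SectorStable p q (vertexPoly lo hi (rotPattern n p q m)))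
    {ρ : ℝ} (hρ : 0 < ρ)
    (hmem : (0 : ℂ) ∈ valueSet lo hi
      ((ρ : ℂ) * Complex.exp ((p * Real.pi / q : ℝ) * Complex.I))) (m : ℤ) :
    0 < support p q lo hi m ρ := by
  have hq0 : 0 < q := by omega
  obtain ⟨a, ha, hza⟩ := mem_valueSet_iff.1 hmem
  have hn : 0 < n := by
    rcases Nat.eq_zero_or_pos n with rfl | hn
    · rw [aeval_polyOf] at hza
      have : a 0 = 0 := by simpa using hza
      exact absurd (this ▸ ha 0) h0
    · exact hn
  set z := (ρ : ℂ) * Complex.exp ((p * Real.pi / q : ℝ) * Complex.I) with hz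
  have hdeg : ∀ m : ℤ, 0 < (vertexPoly lo hi (rotPattern n p q m)).natDegree := by
    intro m
    rw [vertexPoly_eq, natDegree_polyOf]
    · exact hn
    · intro h
      exact h0 (h ▸ vertexCoeff_mem hle _ _)
  have hzero : ∀ β, rotIm β (aeval z (polyOf a)) = 0 := by intro β; rw [hza]; simp [rotIm]
  set β : ℝ := m * Real.pi / q with hβ
  set b := vertexCoeff lo hi (rotPattern n p q m) with hb
  set b' := vertexCoeff lo hi (rotPattern n p q (m + 1)) with hb'
  have hbmem : ∀ i, b i ∈ Set.Icc (lo i) (hi i) := vertexCoeff_mem hle _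
  have hbmem' : ∀ i, b' i ∈ Set.Icc (lo i) (hi i) := vertexCoeff_mem hle _
  have e0 : ((m : ℝ) - 0) * Real.pi / q = β := by rw [hβ, sub_zero]
  have e1 : (((m + 1 : ℤ) : ℝ) - 1) * Real.pi / q = β := by rw [hβ]; push_cast; ring
  have e2 : ((m : ℝ) - 1) * Real.pi / q = β - Real.pi / q := by rw [hβ]; ring
  have e3 : (((m + 1 : ℤ) : ℝ) - 0) * Real.pi / q = β - -(Real.pi / q) := by
    rw [hβ]; push_cast; ring
  have hmax := rotIm_le_rotPattern (p := p) hq0 ha le_rfl zero_le_one m hρ.le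
  have hmax' := rotIm_le_rotPattern (p := p) hq0 hbmem' le_rfl zero_le_one m hρ.le
  have hmax'' := rotIm_le_rotPattern (p := p) hq0 hbmem zero_le_one le_rfl (m + 1) hρ.le
  rw [e0, ← hz, hzero] at hmax
  rw [e0, ← hz] at hmax'
  rw [e1, ← hz] at hmax''
  change _ ≤ rotIm β (aeval z (vertexPoly lo hi (rotPattern n p q (m + 1)))) at hmax''
  refine lt_of_le_of_ne hmax fun hg => ?_
  change 0 = rotIm β (aeval z (vertexPoly lo hi (rotPattern n p q m))) at hg
  have hg' : rotIm β (aeval z (vertexPoly lo hi (rotPattern n p q (m + 1)))) = 0 :=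
    le_antisymm (hmax'.trans_eq hg.symm) (hg.le.trans hmax'')
  -- The member `a` with value 0 attains the maximum in direction β, as do both end vertices, so all
  -- three agree wherever the sine is nonzero.
  have hcoeff : ∀ i : Fin (n + 1), Real.sin ((i : ℕ) * (p * Real.pi / q) - β) ≠ 0 →
      b i = b' i := by
    intro i hs
    have h1 := coeff_eq_of_rotIm_le (p := p) hq0 ha le_rfl zero_le_one m hρ
      (by rw [e0, ← hz, hzero, ← hg]) i (by rwa [e0])
    have h2 := coeff_eq_of_rotIm_le (p := p) hq0 ha zero_le_one le_rfl (m + 1) hρ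
      (by rw [e1, ← hz, hzero, hg']) i (by rwa [e1])
    exact h1.symm.trans h2
  have hderiv : rotIm β (z * aeval z (derivative (vertexPoly lo hi (rotPattern n p q m)))) =
      rotIm β (z * aeval z (derivative (vertexPoly lo hi (rotPattern n p q (m + 1))))) := by
    rw [vertexPoly_eq, vertexPoly_eq, mul_aeval_derivative_polyOf, mul_aeval_derivative_polyOf,
      hz, rotIm_aeval, rotIm_aeval]
    refine Finset.sum_congr rfl fun i _ => ?_
    by_cases hs : Real.sin ((i : ℕ) * (p * Real.pi / q) - β) = 0
    · simp [hs]
    · rw [← hb, ← hb', hcoeff i hs]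
  have hsin := sin_pi_div_pos hq
  -- The neighbouring directions β ∓ π/q place the two end values on opposite sides of 0 along the
  -- edge line.
  have hre : 0 ≤ (Complex.exp (-(β : ℂ) * Complex.I) *
      aeval z (vertexPoly lo hi (rotPattern n p q m))).re := by
    have h := rotIm_le_rotPattern (p := p) hq0 ha zero_le_one le_rfl m hρ.le
    rw [e2, ← hz, hzero, rotIm_sub_angle, ← hg, mul_zero, add_zero] at h
    exact nonneg_of_mul_nonneg_right h hsin
  have hre' : (Complex.exp (-(β : ℂ) * Complex.I) *
      aeval z (vertexPoly lo hi (rotPattern n p q (m + 1)))).re ≤ 0 := by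
    have h := rotIm_le_rotPattern (p := p) hq0 ha le_rfl zero_le_one (m + 1) hρ.le
    rw [e3, ← hz, hzero, rotIm_sub_angle, hg', mul_zero, add_zero, Real.sin_neg, neg_mul,
      ← mul_neg] at h
    exact neg_nonneg.1 (nonneg_of_mul_nonneg_right h hsin)
  have hd := rotIm_derivative_sign hhalf hone (hdeg m) (hst m) hρ hz hg.symm
  have hd' := rotIm_derivative_sign hhalf hone (hdeg (m + 1)) (hst (m + 1)) hρ hz hg'
  rw [← hderiv] at hd'
  -- One shared normal velocity cannot have the sign of both positions.
  refine (mul_nonpos_of_nonpos_of_nonneg hre' ?_).not_gt hd'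
  by_contra! hneg
  exact (mul_nonpos_of_nonneg_of_nonpos hre hneg.le).not_gt hd

/-- The value at the origin: the interval of constant coefficients avoids `0`. -/
lemma zero_notMem_Icc_zero (hq : 0 < q) (hhalf : (1 / 2 : ℝ) ≤ (p : ℝ) / q)
    (hone : (p : ℝ) / q < 1) (hle : ∀ i, lo i ≤ hi i)
    (h0 : (0 : ℝ) ∉ Set.Icc (lo (Fin.last n)) (hi (Fin.last n)))
    (hst : ∀ m : ℤ, SectorStable p q (vertexPoly lo hi (rotPattern n p q m))) :
    (0 : ℝ) ∉ Set.Icc (lo 0) (hi 0) := by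
  have hne : ∀ σ : Superscript n, vertexCoeff lo hi σ (Fin.last n) ≠ 0 := by
    intro σ h
    exact h0 (h ▸ vertexCoeff_mem hle σ _)
  -- Rotations 0 and q read opposite signs at index 0, giving both endpoints of the constant
  -- interval; the leading coefficients share a sign.
  have h1 := coeff_zero_mul_last_pos hhalf hone (hne _) (hst 0)
  have h2 := coeff_zero_mul_last_pos hhalf hone (hne _) (hst q)
  have v1 : vertexCoeff lo hi (rotPattern n p q 0) 0 = hi 0 := by
    simp [vertexCoeff, rotPattern, hq]
  have v2 : vertexCoeff lo hi (rotPattern n p q q) 0 = lo 0 := by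
    have : (-(q : ℤ)) % (2 * q) = q := by
      rw [show (-(q : ℤ)) = q + 2 * q * (-1) by ring, Int.add_mul_emod_self_left,
        Int.emod_eq_of_lt (by omega) (by omega)]
    simp [vertexCoeff, rotPattern, this]
  rw [v1] at h1
  rw [v2] at h2
  have m1 := vertexCoeff_mem hle (rotPattern n p q 0) (Fin.last n)
  have m2 := vertexCoeff_mem hle (rotPattern n p q q) (Fin.last n)
  rintro ⟨hl, hh⟩
  rcases lt_or_ge 0 (lo (Fin.last n)) with h | h
  · have := m2.1
    nlinarith
  · have h' : hi (Fin.last n) < 0 := by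
      by_contra! hc
      exact h0 ⟨h, hc⟩
    have := m1.2
    nlinarith

/-- Zero exclusion on the closed upper boundary ray. -/
lemma zero_notMem_valueSet (hq : 2 ≤ q) (hhalf : (1 / 2 : ℝ) ≤ (p : ℝ) / q)
    (hone : (p : ℝ) / q < 1) (hle : ∀ i, lo i ≤ hi i)
    (h0 : (0 : ℝ) ∉ Set.Icc (lo (Fin.last n)) (hi (Fin.last n)))
    (hst : ∀ m : ℤ, SectorStable p q (vertexPoly lo hi (rotPattern n p q m)))
    {ρ : ℝ} (hρ : 0 ≤ ρ) :
    (0 : ℂ) ∉ valueSet lo hi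
      ((ρ : ℂ) * Complex.exp ((p * Real.pi / q : ℝ) * Complex.I)) := by
  have hq0 : 0 < q := by omega
  intro hmem
  have horigin : (0 : ℂ) ∉ valueSet lo hi
      (((0 : ℝ) : ℂ) * Complex.exp ((p * Real.pi / q : ℝ) * Complex.I)) := by
    intro h
    obtain ⟨a, ha, hz⟩ := mem_valueSet_iff.1 h
    rw [Complex.ofReal_zero, zero_mul, aeval_zero_polyOf] at hz
    have : a 0 = 0 := by exact_mod_cast hz
    exact zero_notMem_Icc_zero hq0 hhalf hone hle h0 hst (this ▸ ha 0)
  have hin : ∀ r : ℝ, 0 ≤ r → (0 : ℂ) ∈ valueSet lo hi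
      ((r : ℂ) * Complex.exp ((p * Real.pi / q : ℝ) * Complex.I)) →
      ∀ m : ℤ, 0 < support p q lo hi m r := by
    intro r hr h
    rcases hr.eq_or_lt with rfl | hr
    · exact absurd h horigin
    · exact support_pos_of_zero_mem hq hhalf hone hle h0 hst hr h
  have hout : ∀ r : ℝ, 0 ≤ r → (0 : ℂ) ∉ valueSet lo hi
      ((r : ℂ) * Complex.exp ((p * Real.pi / q : ℝ) * Complex.I)) →
      ∃ m ∈ Set.Ico (0 : ℤ) (2 * q), support p q lo hi m r < 0 := by
    intro r hr h
    obtain ⟨m, hm⟩ := exists_support_neg hq hle hr h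
    exact ⟨m % (2 * q), ⟨Int.emod_nonneg _ (by positivity), Int.emod_lt_of_pos _ (by positivity)⟩,
      by rwa [support_emod hq0]⟩
  -- By periodicity 2q directions suffice, so the intersection is finite and open.
  have hU : IsOpen (⋂ m ∈ Set.Ico (0 : ℤ) (2 * q), {r | 0 < support p q lo hi m r}) :=
    (Set.finite_Ico _ _).isOpen_biInter fun m _ =>
      isOpen_lt continuous_const (continuous_support m)
  have hW : IsOpen (⋃ m ∈ Set.Ico (0 : ℤ) (2 * q), {r | support p q lo hi m r < 0}) :=
    isOpen_biUnion fun m _ => isOpen_lt (continuous_support m) continuous_const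
  obtain ⟨r, _, hrU, hrW⟩ := isPreconnected_Ici (a := (0 : ℝ)) _ _ hU hW
    (by
      intro r hr
      by_cases h : (0 : ℂ) ∈ valueSet lo hi
        ((r : ℂ) * Complex.exp ((p * Real.pi / q : ℝ) * Complex.I))
      · exact Or.inl (Set.mem_iInter₂.2 fun m _ => hin r hr h m)
      · obtain ⟨m, hm, hneg⟩ := hout r hr h
        exact Or.inr (Set.mem_iUnion₂.2 ⟨m, hm, hneg⟩))
    ⟨ρ, hρ, Set.mem_iInter₂.2 fun m _ => hin ρ hρ hmem m⟩
    ⟨0, Set.mem_Ici.2 le_rfl, by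
      obtain ⟨m, hm, hneg⟩ := hout 0 le_rfl horigin
      exact Set.mem_iUnion₂.2 ⟨m, hm, hneg⟩⟩
  obtain ⟨m, hm, hneg⟩ := Set.mem_iUnion₂.1 hrW
  have hpos := Set.mem_iInter₂.1 hrU m hm
  simp only [Set.mem_ofPred_eq] at hneg hpos
  exact lt_asymm hneg hpos

end Ray

/-! ### Continuity of roots over the box -/

section Homotopy

variable {n : ℕ} {a : Fin (n + 1) → ℝ}

lemma pow_card_le_norm_prod {ε : ℝ} (hε : 0 ≤ ε) (z : ℂ) (s : Multiset ℂ)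
    (h : ∀ r ∈ s, ε ≤ ‖z - r‖) : ε ^ s.card ≤ ‖(s.map fun r => z - r).prod‖ := by
  induction s using Multiset.induction_on with
  | empty => simp
  | cons r s ih =>
    rw [Multiset.card_cons, Multiset.map_cons, Multiset.prod_cons, norm_mul, pow_succ']
    exact mul_le_mul (h r (Multiset.mem_cons_self r s))
      (ih fun x hx => h x (Multiset.mem_cons_of_mem hx)) (by positivity) (norm_nonneg _)

/-- A polynomial that is small at `z` has a root near `z`. -/
lemma exists_root_near (ha : a (Fin.last n) ≠ 0) {ε : ℝ} (hε : 0 ≤ ε) {z : ℂ}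
    (h : ‖aeval z (polyOf a)‖ < |a (Fin.last n)| * ε ^ n) :
    ∃ r, aeval r (polyOf a) = 0 ∧ ‖z - r‖ < ε := by
  by_contra! hall
  set F : ℂ[X] := (polyOf a).map (algebraMap ℝ ℂ) with hF
  have hP : polyOf a ≠ 0 := fun h0 => ha (by rw [← leadingCoeff_polyOf ha, h0, leadingCoeff_zero])
  have hF0 : F ≠ 0 := (Polynomial.map_ne_zero_iff (algebraMap ℝ ℂ).injective).2 hP
  have hsplit : F.Splits := IsAlgClosed.splits F
  have hcard : F.roots.card = n := by
    rw [← hsplit.natDegree_eq_card_roots, hF, natDegree_map, natDegree_polyOf ha]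
  have hlead : F.leadingCoeff = (a (Fin.last n) : ℂ) := by
    rw [hF, leadingCoeff_map, leadingCoeff_polyOf ha, Complex.coe_algebraMap]
  have h1 := pow_card_le_norm_prod hε z F.roots fun r hr =>
    hall r (by rw [← eval_map_algebraMap]; exact (mem_roots hF0).1 hr)
  rw [hcard] at h1
  rw [← eval_map_algebraMap, ← hF, hsplit.eval_eq_prod_roots, norm_mul, hlead, Complex.norm_real,
    Real.norm_eq_abs] at h
  exact absurd (mul_le_mul_of_nonneg_left h1 (abs_nonneg _)) (not_le.2 h)

/-- Cauchy's bound, continuous in the coefficients where the leading one is nonzero, so it confines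
the roots of the whole box to one disc. -/
lemma norm_root_le (ha : a (Fin.last n) ≠ 0) {z : ℂ} (hz : aeval z (polyOf a) = 0) :
    ‖z‖ ≤ ‖a‖ * ‖(a (Fin.last n))⁻¹‖ + 1 := by
  set F : ℂ[X] := (polyOf a).map (algebraMap ℝ ℂ) with hF
  have hP : polyOf a ≠ 0 := fun h0 => ha (by rw [← leadingCoeff_polyOf ha, h0, leadingCoeff_zero])
  have hF0 : F ≠ 0 := (Polynomial.map_ne_zero_iff (algebraMap ℝ ℂ).injective).2 hP
  have hroot : F.IsRoot z := by rw [IsRoot.def, hF, eval_map_algebraMap, hz]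
  have hlead : F.leadingCoeff = (a (Fin.last n) : ℂ) := by
    rw [hF, leadingCoeff_map, leadingCoeff_polyOf ha, Complex.coe_algebraMap]
  have hdeg : F.natDegree = n := by rw [hF, natDegree_map, natDegree_polyOf ha]
  have hsup : Finset.sup (Finset.range F.natDegree) (fun i => ‖F.coeff i‖₊) ≤ ‖a‖₊ := by
    refine Finset.sup_le fun i hi => ?_
    rw [hdeg, Finset.mem_range] at hi
    have hc : F.coeff i = ((a ⟨i, by omega⟩ : ℝ) : ℂ) := by
      rw [hF, coeff_map, Complex.coe_algebraMap, ← coeff_polyOf a ⟨i, by omega⟩]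
    rw [hc, Complex.nnnorm_real]
    exact nnnorm_le_pi_nnnorm a _
  have hb := (IsRoot.norm_lt_cauchyBound hF0 hroot).le
  have hle : cauchyBound F ≤ ‖a‖₊ * ‖(a (Fin.last n))⁻¹‖₊ + 1 := by
    unfold cauchyBound
    rw [hlead, Complex.nnnorm_real, nnnorm_inv, ← div_eq_mul_inv]
    gcongr
  exact_mod_cast hb.trans hle

lemma continuous_aeval_polyOf :
    Continuous fun x : (Fin (n + 1) → ℝ) × ℂ => aeval x.2 (polyOf x.1) := by
  simp only [aeval_polyOf]
  fun_prop

/-- Boundary crossing: in a box of polynomials of constant degree without roots on `h = 0`, if one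
member has all its roots in `h < 0`, then every member does. -/
lemma forall_root_neg_of_exists {lo hi : Fin (n + 1) → ℝ}
    (h0 : (0 : ℝ) ∉ Set.Icc (lo (Fin.last n)) (hi (Fin.last n))) {h : ℂ → ℝ} (hcont : Continuous h)
    (hexcl : ∀ b ∈ Set.Icc lo hi, ∀ z, aeval z (polyOf b) = 0 → h z ≠ 0)
    {b₀ : Fin (n + 1) → ℝ} (hb₀ : b₀ ∈ Set.Icc lo hi)
    (hstable : ∀ z, aeval z (polyOf b₀) = 0 → h z < 0) :
    ∀ b ∈ Set.Icc lo hi, ∀ z, aeval z (polyOf b) = 0 → h z < 0 := by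
  have hlast : ∀ b ∈ Set.Icc lo hi, b (Fin.last n) ≠ 0 := by
    intro b hb hb0
    exact h0 (hb0 ▸ ⟨hb.1 _, hb.2 _⟩)
  obtain ⟨C, hC⟩ := (isCompact_Icc (a := lo) (b := hi)).exists_bound_of_continuousOn
    (f := fun b => ‖b‖ * ‖(b (Fin.last n))⁻¹‖ + 1) (by
      have : ContinuousOn (fun b : Fin (n + 1) → ℝ => (b (Fin.last n))⁻¹) (Set.Icc lo hi) :=
        (continuous_apply _).continuousOn.inv₀ hlast
      fun_prop)
  have hbound : ∀ b ∈ Set.Icc lo hi, ∀ z : ℂ, aeval z (polyOf b) = 0 → ‖z‖ ≤ C := fun b hb z hz =>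
    (norm_root_le (hlast b hb) hz).trans ((Real.le_norm_self _).trans (hC b hb))
  -- `A` is closed as a projection of a compact set, and `W` below is open since roots persist
  -- nearby; with no root on h = 0 they coincide on the box.
  let A : Set (Fin (n + 1) → ℝ) := Prod.fst '' ((Set.Icc lo hi ×ˢ Metric.closedBall (0 : ℂ) C) ∩
    {x | aeval x.2 (polyOf x.1) = 0 ∧ 0 ≤ h x.2})
  have hA : IsClosed A := by
    refine (IsCompact.image ?_ continuous_fst).isClosed
    refine (isCompact_Icc.prod (isCompact_closedBall _ _)).inter_right ?_
    exact (isClosed_eq continuous_aeval_polyOf continuous_const).inter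
      (isClosed_le continuous_const (hcont.comp continuous_snd))
  let W : Set (Fin (n + 1) → ℝ) :=
    {b | b (Fin.last n) ≠ 0 ∧ ∃ z, aeval z (polyOf b) = 0 ∧ 0 < h z}
  have hW : IsOpen W := by
    rw [isOpen_iff_mem_nhds]
    rintro b ⟨hb, z, hz, hpos⟩
    obtain ⟨ε, hε, hball⟩ := Metric.isOpen_iff.1 (isOpen_lt continuous_const hcont) z hpos
    have hopen : IsOpen {c : Fin (n + 1) → ℝ |
        ‖aeval z (polyOf c)‖ < |c (Fin.last n)| * ε ^ n} := by
      have : Continuous fun c : Fin (n + 1) → ℝ => aeval z (polyOf c) :=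
        continuous_aeval_polyOf.comp (continuous_id.prodMk continuous_const)
      exact isOpen_lt this.norm (by fun_prop)
    filter_upwards [hopen.mem_nhds (show ‖aeval z (polyOf b)‖ < |b (Fin.last n)| * ε ^ n by
      rw [hz, norm_zero]; positivity)] with c hc
    have hc0 : c (Fin.last n) ≠ 0 := by
      intro h0
      have : ‖aeval z (polyOf c)‖ < |c (Fin.last n)| * ε ^ n := hc
      rw [h0, abs_zero, zero_mul] at this
      exact absurd this (not_lt.2 (norm_nonneg _))
    obtain ⟨r, hr, hzr⟩ := exists_root_near hc0 hε.le hc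
    refine ⟨hc0, r, hr, hball ?_⟩
    rwa [Metric.mem_ball, dist_comm, dist_eq_norm]
  intro b hb z hz
  by_contra! hnonneg
  obtain ⟨c, hc, hcA, hcW⟩ := (convex_Icc lo hi).isPreconnected Aᶜ W hA.isOpen_compl hW
    (by
      intro c hc
      by_cases hcA : c ∈ A
      · obtain ⟨⟨_, w⟩, ⟨_, hw, hw'⟩, rfl⟩ := hcA
        exact Or.inr ⟨hlast _ hc, w, hw, lt_of_le_of_ne hw' (hexcl _ hc w hw).symm⟩
      · exact Or.inl hcA)
    ⟨b₀, hb₀, by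
      rintro ⟨⟨_, w⟩, ⟨_, hw, hw'⟩, rfl⟩
      exact absurd (hstable w hw) (not_lt.2 hw')⟩
    ⟨b, hb, hlast b hb, z, hz, lt_of_le_of_ne hnonneg (hexcl b hb z hz).symm⟩
  obtain ⟨_, w, hw, hw'⟩ := hcW
  exact hcA ⟨(c, w), ⟨⟨hc, mem_closedBall_zero_iff.2 (hbound c hc w hw)⟩, hw, hw'.le⟩, rfl⟩

end Homotopy

/-! ### Stability of the family and the theorem -/

lemma aeval_conj_eq_zero {f : ℝ[X]} {z : ℂ} (h : aeval z f = 0) :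
    aeval ((starRingEnd ℂ) z) f = 0 := by
  rw [Polynomial.aeval_conj, h, map_zero]

/-- The family is stable as soon as the vertices read off the circle are. -/
lemma family_stable {n p q : ℕ} (hq : 2 ≤ q) (hhalf : (1 / 2 : ℝ) ≤ (p : ℝ) / q)
    (hone : (p : ℝ) / q < 1) {lo hi : Fin (n + 1) → ℝ} (hle : ∀ i, lo i ≤ hi i)
    (h0 : (0 : ℝ) ∉ Set.Icc (lo (Fin.last n)) (hi (Fin.last n)))
    (hst : ∀ m : ℤ, SectorStable p q (vertexPoly lo hi (rotPattern n p q m))) :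
    ∀ f ∈ intervalFamily lo hi, SectorStable p q f := by
  rintro _ ⟨a, ha, rfl⟩
  have hupper : ∀ b ∈ Set.Icc lo hi, ∀ ρ : ℝ, 0 ≤ ρ →
      aeval ((ρ : ℂ) * Complex.exp ((p * Real.pi / q : ℝ) * Complex.I)) (polyOf b) ≠ 0 :=
    fun b hb ρ hρ h => zero_notMem_valueSet hq hhalf hone hle h0 hst hρ
      (mem_valueSet_iff.2 ⟨b, fun i => ⟨hb.1 i, hb.2 i⟩, h⟩)
  have key := forall_root_neg_of_exists h0
    (h := fun z => z.re - ‖z‖ * Real.cos (p * Real.pi / q)) (by fun_prop) ?_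
    (b₀ := vertexCoeff lo hi (rotPattern n p q 0))
    ⟨fun i => (vertexCoeff_mem hle _ i).1, fun i => (vertexCoeff_mem hle _ i).2⟩
    (fun z hz => sub_neg.2 ((mem_sector_iff hhalf hone).1 (hst 0 z hz)))
  · intro z hz
    exact (mem_sector_iff hhalf hone).2
      (sub_neg.1 (key a ⟨fun i => (ha i).1, fun i => (ha i).2⟩ z hz))
  -- The zero set of h is the origin and the two rays; conjugation moves the lower ray to the upper.
  · intro b hb z hz hbd
    by_cases hz0 : z = 0
    · exact hupper b hb 0 le_rfl (by simpa [hz0] using hz)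
    · obtain ⟨ρ, θ, hρ, hθ, rfl⟩ :=
        mem_boundaryRays_of_re_eq hhalf hone hz0 (sub_eq_zero.1 hbd)
      rcases hθ with rfl | rfl
      · exact hupper b hb ρ hρ.le hz
      · have := aeval_conj_eq_zero hz
        rw [map_mul, Complex.conj_ofReal, ← Complex.exp_conj] at this
        refine hupper b hb ρ hρ.le ?_
        simpa using this

end LeftSector

theorem mainTheorem1 (n p q : ℕ) (hp : 0 < p) (hq : 0 < q) (hpq : Nat.Coprime p q)
    (hhalf : (1 / 2 : ℝ) ≤ (p : ℝ) / (q : ℝ)) (hone : (p : ℝ) / (q : ℝ) < 1)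
    (lo hi : Fin (n + 1) → ℝ) (hle : ∀ i, lo i ≤ hi i) :
    -- the superscripts read off the circle are exactly those of the critical vertices
    ((∀ i, lo i < hi i) →
      Set.range (LeftSector.circlePattern n p q) =
          {σ | LeftSector.vertexPoly lo hi σ ∈ LeftSector.criticalVertices p q lo hi} ∧
        (LeftSector.criticalVertices p q lo hi).ncard = 2 * min q (n + 1)) ∧
    -- degenerate intervals included, the circle yields exactly the critical vertices
    (Set.range (fun x : ZMod (2 * q) =>
        LeftSector.vertexPoly lo hi (LeftSector.circlePattern n p q x)) =
      LeftSector.criticalVertices p q lo hi) ∧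
    -- stability of a family of order `n` is decided by these vertices
    ((0 : ℝ) ∉ Set.Icc (lo (Fin.last n)) (hi (Fin.last n)) →
      ((∀ f ∈ LeftSector.intervalFamily lo hi, LeftSector.SectorStable p q f) ↔
        ∀ x : ZMod (2 * q), LeftSector.SectorStable p q
          (LeftSector.vertexPoly lo hi (LeftSector.circlePattern n p q x)))) := by
  have hq2 : 2 ≤ q := by
    by_contra! h
    obtain rfl : q = 1 := by omega
    rw [Nat.cast_one, div_one] at hone
    exact absurd hone (not_lt.2 (by exact_mod_cast hp))
  refine ⟨fun hlt => LeftSector.circlePattern_range_eq_and_ncard hq hpq hlt,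
    LeftSector.range_eq_criticalVertices hq hle, fun h0 => ⟨fun h x => ?_, fun h => ?_⟩⟩
  · exact h _ ⟨_, LeftSector.vertexCoeff_mem hle _, rfl⟩
  · refine LeftSector.family_stable hq2 hhalf hone hle h0 fun m => ?_
    rw [← LeftSector.circlePattern_intCast n p q hq]
    exact h _
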